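/- **Theorem 4.** A parking function of length $n$ is a vector $p=(p_1,\dots,p_n)$ of integers with $1\le p_i\le n$ whose weakly increasing rearrangement $p_{(1)}\le\dots\le p_{(n)}$ satisfies $p_{(i)}\le i$ for $1\le i\le n$. Its area is $\mathrm{Area}(p)=\frac{n(n+1)}{2}-(p_1+\dots+p_n)$. Let $A_n$ be the area of a uniformly random parking function of length $n$, and let $E_1(n)=\mathbb{E}[A_n]$. Then, for all $n\ge 0$, $$ E_1(n)=-\frac n2+\frac12\,\frac{(n+1)!}{(n+1)^n}\sum_{k=0}^{n-1}\frac{(n+1)^k}{k!}, $$ and the fourth factorial moment $E_4(n)=\mathbb{E}[A_n(A_n-1)(A_n-2)(A_n-3)]$ is $$ E_4(n)=\frac{221}{1008}n^6+\frac{63737}{30240}n^5+\frac{101897}{15120}n^4+\frac{22217}{5040}n^3-\frac{1375}{189}n^2-\frac{187463}{30240}n $$ $$ \qquad+\left(-\frac{35}{16}n^4-\frac{449}{27}n^3-\frac{130243}{2520}n^2-\frac{7409}{105}n-\frac{503803}{15120}\right)E_1(n). $$ Moreover, as $n\to\infty$, $$ E_4(n)=\frac{221}{1008}\,n^6+O\!\left(n^{11/2}\right).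 $$ -/

import Mathlib

open Filter Asymptotics

/-- `p = (p₁, …, pₙ)` is a parking function of length `n`: `1 ≤ pᵢ ≤ n` for all `i`, and the weakly
increasing rearrangement `p₍₁₎ ≤ … ≤ p₍ₙ₎` of `p` satisfies `p₍ᵢ₎ ≤ i` for `1 ≤ i ≤ n`.
Positions are indexed from `0` here, so the `i`-th bound reads `i + 1`. -/
def IsParkingFunction {n : ℕ} (p : Fin n → ℕ) : Prop :=
  (∀ i, 1 ≤ p i ∧ p i ≤ n) ∧ ∀ i : Fin n, (p ∘ Tuple.sort p) i ≤ (i : ℕ) + 1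

instance {n : ℕ} : DecidablePred (IsParkingFunction (n := n)) := fun p => by
  unfold IsParkingFunction
  infer_instance

/-- The finite set of all parking functions of length `n`. -/
def parkingFunctions (n : ℕ) : Finset (Fin n → ℕ) :=
  (Fintype.piFinset fun _ : Fin n => Finset.Icc 1 n).filter IsParkingFunction

theorem mem_parkingFunctions {n : ℕ} (p : Fin n → ℕ) :
    p ∈ parkingFunctions n ↔ IsParkingFunction p := by
  simp only [parkingFunctions, Finset.mem_filter, Fintype.mem_piFinset, Finset.mem_Icc]
  exact ⟨fun h => h.2, fun h => ⟨h.1, h⟩⟩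

/-- The area statistic `n (n + 1) / 2 - (p₁ + ⋯ + pₙ)`, as a real number. -/
noncomputable def parkingArea {n : ℕ} (p : Fin n → ℕ) : ℝ :=
  (n : ℝ) * ((n : ℝ) + 1) / 2 - ∑ i, (p i : ℝ)

/-- The expectation of a statistic `f` on a uniformly random parking function of length `n`. -/
noncomputable def parkingExpectation (n : ℕ) (f : (Fin n → ℕ) → ℝ) : ℝ :=
  (∑ p ∈ parkingFunctions n, f p) / ((parkingFunctions n).card : ℝ)

/-- The `k`-th factorial moment of area on parking functions of length `n`, i.e. the expectation
of `A (A - 1) ⋯ (A - k + 1)`, where `A` is the area. -/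
noncomputable def areaFactorialMoment (k n : ℕ) : ℝ :=
  parkingExpectation n fun p => ∏ j ∈ Finset.range k, (parkingArea p - (j : ℝ))

/-- `E₁(n)`: the expectation of area on parking functions of length `n`. -/
noncomputable def expectedArea (n : ℕ) : ℝ :=
  parkingExpectation n fun p => parkingArea p

/-! Let cars choose spots on an infinite street. The cars parked before the first empty spot form a
parking function, and all other cars prefer spots beyond that gap. Weighting a preference v by q^v
gives `sum_choose_mul_parking_geometric`. With Q = 1/q this reads A(x) G(x) = G(Qx), where G = ∑
Q^(n choose 2) xⁿ/n! and A is the exponential generating function of the area enumerators, with x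
scaled by Q - 1. Since G'(x) = G(Qx), it follows that A' = A (Q A(Qx) - A), which is
`areaEnumerator_succ_of_one_lt`.

The Taylor coefficients at Q = 1 carry the factorial moments. Write S_j for `areaSeries j`, T = S_0,
W = 1 - T, Z = 1/W and θ = x d/dx. Order 0 gives θT = Z - 1, hence θZ = Z³ - Z². Order j ≥ 1 gives a
linear equation θS_j = Z² S_j + (known terms), so S_1, …, S_4 can be found in turn as combinations
of W and powers of Z; `eq_zero_of_euler_eq` certifies each of them.

As θ - 1 multiplies the coefficient of x^(n+1) by n, the formula for E_4 is a linear relation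
between S_4 and the series (θ - 1)^i S_0, (θ - 1)^i S_1 (`areaCoeff_four`). The formula for E_1
comes from 2 S_1 = (Z - 1)² - (θ - 1)T and the explicit coefficients of the series T^k Z. Stirling's
formula then gives E_1 = O(n^(3/2)), which fixes the error term of E_4. -/

/-! ### The first block of a preference function -/

/-- `f` restricted to `S` is a parking function with values counted from `0`: at least `j` elements
of `S` have value below `j`, for every `j` up to the size of `S`. -/
def ParksOn {α : Type*} (S : Finset α) (f : α → ℕ) : Prop :=
  ∀ j ≤ S.card, j ≤ (S.filter fun i => f i < j).card

instance {α : Type*} (S : Finset α) (f : α → ℕ) : Decidable (ParksOn S f) := by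
  unfold ParksOn
  infer_instance

theorem ParksOn.lt {α : Type*} {S : Finset α} {f : α → ℕ} (h : ParksOn S f) {i : α} (hi : i ∈ S) :
    f i < S.card := by
  have h1 := h _ le_rfl
  have h2 : (S.filter fun i => f i < S.card) = S :=
    Finset.eq_of_subset_of_card_le (Finset.filter_subset _ _) h1
  rw [← h2] at hi
  exact (Finset.mem_filter.1 hi).2

/-- `S` is the set of cars parked before the first empty spot, for the preferences `f` on an
infinite street with spots numbered from `0`. -/
def IsFirstBlock {α : Type*} (S : Finset α) (f : α → ℕ) : Prop :=
  ParksOn S f ∧ ∀ i ∉ S, S.card < f i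

instance {α : Type*} [Fintype α] [DecidableEq α] (S : Finset α) (f : α → ℕ) :
    Decidable (IsFirstBlock S f) := by
  unfold IsFirstBlock
  infer_instance

theorem IsFirstBlock.eq_filter {α : Type*} [Fintype α] {S : Finset α} {f : α → ℕ}
    (h : IsFirstBlock S f) : S = Finset.univ.filter fun i => f i < S.card + 1 := by
  ext i
  simp only [Finset.mem_filter, Finset.mem_univ, true_and]
  constructor
  · intro hi
    exact (h.1.lt hi).trans (Nat.lt_succ_self _)
  · intro hi
    by_contra hn
    have := h.2 i hn
    omega

/-- A larger block `S'` would contain at least `S.card + 1` cars with value at most `S.card`, but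
all such cars lie in `S`. -/
theorem IsFirstBlock.card_le {α : Type*} [Fintype α] {S S' : Finset α} {f : α → ℕ}
    (h : IsFirstBlock S f) (h' : IsFirstBlock S' f) : S'.card ≤ S.card := by
  by_contra! hlt
  have h1 := h'.1 (S.card + 1) hlt
  have h2 : (S'.filter fun i => f i < S.card + 1) ⊆ S := by
    intro i hi
    rw [h.eq_filter]
    simpa using (Finset.mem_filter.1 hi).2
  have := Finset.card_le_card h2
  omega

theorem existsUnique_isFirstBlock {α : Type*} [Fintype α] (f : α → ℕ) :
    ∃! S : Finset α, IsFirstBlock S f := by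
  classical
  -- The first empty spot is the least k such that at most k cars prefer spots 0, …, k.
  have hex : ∃ k, (Finset.univ.filter fun i => f i < k + 1).card ≤ k :=
    ⟨Fintype.card α, Finset.card_le_univ _⟩
  set k := Nat.find hex with hk
  have hk1 : (Finset.univ.filter fun i => f i < k + 1).card ≤ k := Nat.find_spec hex
  have hmin : ∀ j ≤ k, j ≤ (Finset.univ.filter fun i => f i < j).card := by
    intro j hj
    rcases j with _ | j
    · exact Nat.zero_le _
    · have := Nat.find_min hex (m := j) (by omega)
      omega
  have hsub : (Finset.univ.filter fun i => f i < k) ⊆ Finset.univ.filter fun i => f i < k + 1 := by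
    intro i
    simp only [Finset.mem_filter, Finset.mem_univ, true_and]
    omega
  have hcard : (Finset.univ.filter fun i => f i < k + 1).card = k :=
    le_antisymm hk1 ((hmin k le_rfl).trans (Finset.card_le_card hsub))
  have hblock : IsFirstBlock (Finset.univ.filter fun i => f i < k + 1) f := by
    refine ⟨fun j hj => ?_, fun i hi => ?_⟩
    · rw [hcard] at hj
      refine (hmin j hj).trans (Finset.card_le_card ?_)
      intro i
      simp only [Finset.mem_filter, Finset.mem_univ, true_and]
      omega
    · rw [hcard]
      simp only [Finset.mem_filter, Finset.mem_univ, true_and, not_lt] at hi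
      omega
  refine ⟨_, hblock, fun S hS => ?_⟩
  have := le_antisymm (hS.card_le hblock) (hblock.card_le hS)
  rw [hS.eq_filter, ← this, hcard]

/-- The weighted count of zero-indexed parking functions on `α` with values below `N`. -/
noncomputable def parkingWeight (α : Type*) [Fintype α] [DecidableEq α] (N : ℕ) (q : ℝ) : ℝ :=
  ∑ f : α → Fin N, if ParksOn Finset.univ (fun i => (f i : ℕ)) then ∏ i, q ^ (f i : ℕ) else 0

theorem parkingWeight_congr {α β : Type*} [Fintype α] [Fintype β] [DecidableEq α] [DecidableEq β]
  (e : α ≃ β) (N : ℕ) (q : ℝ) :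
    parkingWeight α N q = parkingWeight β N q := by
  unfold parkingWeight
  refine Fintype.sum_equiv (e.arrowCongr (Equiv.refl (Fin N))) _ _ fun f => ?_
  have hpark : ParksOn Finset.univ (fun i => (f i : ℕ)) ↔
      ParksOn Finset.univ (fun i => ((e.arrowCongr (Equiv.refl (Fin N))) f i : ℕ)) := by
    unfold ParksOn
    simp only [Finset.card_univ, Fintype.card_congr e]
    refine forall₂_congr fun j _ => ?_
    have : (Finset.univ.filter fun i => ((f i : ℕ)) < j).card =
        (Finset.univ.filter fun i => ((e.arrowCongr (Equiv.refl (Fin N))) f i : ℕ) < j).card := by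
      refine Finset.card_equiv e fun i => ?_
      simp
    rw [this]
  have hprod : ∏ i, q ^ (f i : ℕ) = ∏ i, q ^ ((e.arrowCongr (Equiv.refl (Fin N))) f i : ℕ) := by
    refine Fintype.prod_equiv e _ _ fun i => ?_
    simp
  rw [hprod]
  exact if_congr hpark rfl rfl

/-- Being the first block constrains the cars inside and outside `S` independently, so the sum
factors. Truncating the street to `N` spots keeps every sum finite. -/
theorem sum_isFirstBlock {α : Type*} [Fintype α] [DecidableEq α] (S : Finset α) (N : ℕ) (q : ℝ) :
    (∑ f : α → Fin N, if IsFirstBlock S (fun i => (f i : ℕ)) then ∏ i, q ^ (f i : ℕ) else 0) =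
      parkingWeight S N q *
        (∑ v : Fin N, if S.card < (v : ℕ) then q ^ (v : ℕ) else 0) ^
          (Fintype.card α - S.card) := by
  have hpow : (∑ v : Fin N, if S.card < (v : ℕ) then q ^ (v : ℕ) else 0) ^
          (Fintype.card α - S.card) =
      ∑ h : {i // i ∉ S} → Fin N, if ∀ i, S.card < (h i : ℕ) then ∏ i, q ^ (h i : ℕ) else 0 := by
    have h1 := Finset.prod_univ_sum (ι := {i // i ∉ S}) (fun _ => (Finset.univ : Finset (Fin N)))
      (fun _ v => if S.card < (v : ℕ) then q ^ (v : ℕ) else (0 : ℝ))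
    rw [Finset.prod_const, Finset.card_univ, Fintype.card_subtype_compl, Fintype.card_coe] at h1
    rw [h1, Fintype.piFinset_univ]
    refine Finset.sum_congr rfl fun h _ => ?_
    rw [Finset.prod_ite_zero]
    simp
  rw [hpow, parkingWeight, Finset.sum_mul_sum, ← Fintype.sum_prod_type']
  refine Fintype.sum_equiv (Equiv.piEquivPiSubtypeProd (· ∈ S) fun _ => Fin N) _ _ fun f => ?_
  have hprod : ∏ i, q ^ (f i : ℕ) =
      (∏ i : {i // i ∈ S}, q ^ (f i : ℕ)) * ∏ i : {i // i ∉ S}, q ^ (f i : ℕ) := by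
    convert (Fintype.prod_subtype_mul_prod_subtype (· ∈ S) fun i => q ^ (f i : ℕ)).symm
  have hpark : ParksOn S (fun i => (f i : ℕ)) ↔
      ParksOn Finset.univ (fun i : {i // i ∈ S} => (f i : ℕ)) := by
    unfold ParksOn
    simp only [Finset.card_univ, Fintype.card_coe]
    refine forall₂_congr fun j _ => ?_
    have : (S.filter fun i => (f i : ℕ) < j).card =
        (Finset.univ.filter fun i : {i // i ∈ S} => (f i : ℕ) < j).card := by
      rw [Finset.univ_eq_attach, Finset.filter_attach (fun i => (f i : ℕ) < j) S, Finset.card_map,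
        Finset.card_attach]
    rw [this]
  have hcompl : (∀ i ∉ S, S.card < (f i : ℕ)) ↔ ∀ i : {i // i ∉ S}, S.card < (f i : ℕ) := by
    simp
  simp only [Equiv.piEquivPiSubtypeProd_apply]
  simp only [IsFirstBlock, hpark, hcompl, hprod]
  by_cases h1 : ParksOn Finset.univ (fun i : {i // i ∈ S} => (f i : ℕ)) <;>
  by_cases h2 : ∀ i : {i // i ∉ S}, S.card < (f i : ℕ) <;> simp only [h1, h2] <;> simp

theorem sum_pow_eq_sum_parkingWeight (n N : ℕ) (q : ℝ) :
    (∑ v : Fin N, q ^ (v : ℕ)) ^ n =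
      ∑ k ∈ Finset.range (n + 1), (n.choose k : ℝ) * (parkingWeight (Fin k) N q *
        (∑ v : Fin N, if k < (v : ℕ) then q ^ (v : ℕ) else 0) ^ (n - k)) := by
  classical
  have h1 : (∑ v : Fin N, q ^ (v : ℕ)) ^ n = ∑ f : Fin n → Fin N, ∏ i, q ^ (f i : ℕ) := by
    have h1 := Finset.prod_univ_sum (ι := Fin n) (fun _ => (Finset.univ : Finset (Fin N)))
      (fun _ v => q ^ (v : ℕ))
    rw [Finset.prod_const, Finset.card_univ, Fintype.card_fin, Fintype.piFinset_univ] at h1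
    exact h1
  have h2 : ∀ f : Fin n → Fin N, ∏ i, q ^ (f i : ℕ) =
      ∑ S : Finset (Fin n),
        if IsFirstBlock S (fun i => (f i : ℕ)) then ∏ i, q ^ (f i : ℕ) else 0 := by
    intro f
    obtain ⟨S, hS, hu⟩ := existsUnique_isFirstBlock fun i => (f i : ℕ)
    rw [Finset.sum_eq_single S]
    · rw [if_pos hS]
    · intro S' _ hne
      rw [if_neg fun h => hne (hu _ h)]
    · simp
  rw [h1, Finset.sum_congr rfl fun f _ => h2 f, Finset.sum_comm]
  simp only [sum_isFirstBlock, Fintype.card_fin]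
  have h3 : ∀ S : Finset (Fin n), parkingWeight S N q = parkingWeight (Fin S.card) N q := fun S =>
    parkingWeight_congr S.equivFin N q
  simp only [h3]
  rw [← Finset.powerset_univ, Finset.sum_powerset_apply_card
    (fun k => parkingWeight (Fin k) N q *
        (∑ v : Fin N, if k < (v : ℕ) then q ^ (v : ℕ) else 0) ^ (n - k))]
  simp [nsmul_eq_mul]

/-! ### From the sorted definition to counting, and the limit of an infinite street -/

theorem isParkingFunction_iff_parksOn {n : ℕ} (p : Fin n → ℕ) :
    IsParkingFunction p ↔ (∀ i, 1 ≤ p i) ∧ ParksOn Finset.univ fun i => p i - 1 := by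
  constructor
  · rintro ⟨h1, h2⟩
    refine ⟨fun i => (h1 i).1, fun j hj => ?_⟩
    rw [Finset.card_univ, Fintype.card_fin] at hj
    have hsub : (Finset.univ.map (Fin.castLEEmb hj)).map (Tuple.sort p).toEmbedding ⊆
        Finset.univ.filter fun i => p i - 1 < j := by
      intro i hi
      simp only [Finset.mem_map, Finset.mem_univ, true_and, exists_exists_eq_and,
        Equiv.coe_toEmbedding] at hi
      obtain ⟨a, rfl⟩ := hi
      have := h2 (Fin.castLEEmb hj a)
      simp only [Function.comp_apply, Fin.castLEEmb_apply, Fin.val_castLE] at this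
      simp only [Finset.mem_filter, Finset.mem_univ, true_and, Fin.castLEEmb_apply]
      have := a.2
      omega
    simpa using Finset.card_le_card hsub
  · rintro ⟨h1, h2⟩
    refine ⟨fun i => ⟨h1 i, ?_⟩, fun i => ?_⟩
    · have := h2.lt (Finset.mem_univ i)
      rw [Finset.card_univ, Fintype.card_fin] at this
      omega
    · by_contra! hlt
      have hc : (i : ℕ) + 1 ≤ (Finset.univ.filter fun a => p a - 1 < (i : ℕ) + 1).card :=
        h2 (i + 1) (by simp only [Finset.card_univ, Fintype.card_fin]; omega)
      have hsub : (Finset.univ.filter fun a => p a - 1 < (i : ℕ) + 1) ⊆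
          (Finset.Iio i).map (Tuple.sort p).toEmbedding := by
        intro a ha
        simp only [Finset.mem_filter, Finset.mem_univ, true_and] at ha
        rw [Finset.mem_map_equiv, Finset.mem_Iio]
        by_contra! hia
        have hm := Tuple.monotone_sort p hia
        simp only [Function.comp_apply, Equiv.apply_symm_apply] at hm hlt
        omega
      have := Finset.card_le_card hsub
      rw [Finset.card_map, Fin.card_Iio] at this
      omega

/-- Parking forces all values below `n`, so the truncation at `N ≥ n` is invisible; this lets `N`
tend to infinity. -/
theorem parkingWeight_eq_sum {n N : ℕ} (h : n ≤ N) (q : ℝ) :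
    parkingWeight (Fin n) N q = ∑ p ∈ parkingFunctions n, ∏ i, q ^ (p i - 1) := by
  rw [parkingWeight, ← Finset.sum_filter]
  refine Finset.sum_bij (fun f _ i => (f i : ℕ) + 1) ?_ ?_ ?_ ?_
  · intro f hf
    rw [mem_parkingFunctions, isParkingFunction_iff_parksOn]
    simpa using hf
  · intro f _ g _ hfg
    funext i
    have := congrFun hfg i
    exact Fin.ext (by simpa using this)
  · intro p hp
    rw [mem_parkingFunctions, isParkingFunction_iff_parksOn] at hp
    have hlt : ∀ i, p i - 1 < N := fun i => by
      have := hp.2.lt (Finset.mem_univ i)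
      rw [Finset.card_univ, Fintype.card_fin] at this
      omega
    refine ⟨fun i => ⟨p i - 1, hlt i⟩, ?_, ?_⟩
    · simpa using hp.2
    · funext i
      have := hp.1 i
      simp only
      omega
  · intro f _
    simp

theorem tendsto_sum_ite_geometric {q : ℝ} (h0 : 0 ≤ q) (h1 : q < 1) (k : ℕ) :
    Tendsto (fun N : ℕ => ∑ v : Fin N, if k < (v : ℕ) then q ^ (v : ℕ) else 0) atTop
      (nhds (q ^ (k + 1) * (1 - q)⁻¹)) := by
  have hs : HasSum (fun v : ℕ => if k < v then q ^ v else 0) (q ^ (k + 1) * (1 - q)⁻¹) := by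
    rw [← hasSum_nat_add_iff' (k + 1)]
    have hz : ∑ i ∈ Finset.range (k + 1), (if k < i then q ^ i else 0) = 0 := by
      refine Finset.sum_eq_zero fun i hi => ?_
      rw [if_neg]
      have := Finset.mem_range.1 hi
      omega
    rw [hz, sub_zero]
    refine ((hasSum_geometric_of_lt_one h0 h1).mul_left (q ^ (k + 1))).congr_fun fun i => ?_
    rw [if_pos (by omega), pow_add, mul_comm]
  refine hs.tendsto_sum_nat.congr fun N => ?_
  rw [Fin.sum_univ_eq_sum_range (fun v => if k < v then q ^ v else 0)]

theorem sum_choose_mul_parking_geometric {q : ℝ} (h0 : 0 ≤ q) (h1 : q < 1) (n : ℕ) :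
    ∑ k ∈ Finset.range (n + 1), (n.choose k : ℝ) *
      ((∑ p ∈ parkingFunctions k, ∏ i, q ^ (p i - 1)) *
        (q ^ (k + 1) * (1 - q)⁻¹) ^ (n - k)) = ((1 - q)⁻¹) ^ n := by
  have hl : Tendsto (fun N : ℕ => (∑ v : Fin N, q ^ (v : ℕ)) ^ n) atTop
      (nhds (((1 - q)⁻¹) ^ n)) := by
    refine ((hasSum_geometric_of_lt_one h0 h1).tendsto_sum_nat.congr fun N => ?_).pow n
    rw [Fin.sum_univ_eq_sum_range (fun v => q ^ v)]
  refine tendsto_nhds_unique ?_ hl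
  have hr : Tendsto (fun N : ℕ => ∑ k ∈ Finset.range (n + 1), (n.choose k : ℝ) *
      ((∑ p ∈ parkingFunctions k, ∏ i, q ^ (p i - 1)) *
        (∑ v : Fin N, if k < (v : ℕ) then q ^ (v : ℕ) else 0) ^ (n - k))) atTop
      (nhds (∑ k ∈ Finset.range (n + 1), (n.choose k : ℝ) *
      ((∑ p ∈ parkingFunctions k, ∏ i, q ^ (p i - 1)) *
        (q ^ (k + 1) * (1 - q)⁻¹) ^ (n - k)))) :=
    tendsto_finsetSum _ fun k _ =>
      (((tendsto_sum_ite_geometric h0 h1 k).pow (n - k)).const_mul _).const_mul _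
  refine hr.congr' ?_
  filter_upwards [eventually_ge_atTop n] with N hN
  rw [sum_pow_eq_sum_parkingWeight]
  refine Finset.sum_congr rfl fun k hk => ?_
  have := Finset.mem_range.1 hk
  rw [parkingWeight_eq_sum (by omega)]

/-! ### The area enumerator and its functional equation -/

/-- The area of a parking function as a natural number. -/
def parkingAreaNat {n : ℕ} (p : Fin n → ℕ) : ℕ :=
  (n + 1).choose 2 - ∑ i, p i

theorem sum_fin_val_add_one (n : ℕ) : ∑ i : Fin n, ((i : ℕ) + 1) = (n + 1).choose 2 := by
  rw [Fin.sum_univ_eq_sum_range (fun i => i + 1)]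
  induction n with
  | zero => rfl
  | succ n ih =>
    rw [Finset.sum_range_succ, ih, Nat.choose_succ_succ' (n + 1) 1, Nat.choose_one_right, add_comm]

theorem IsParkingFunction.sum_le {n : ℕ} {p : Fin n → ℕ} (h : IsParkingFunction p) :
    ∑ i, p i ≤ (n + 1).choose 2 := by
  rw [← sum_fin_val_add_one, ← Equiv.sum_comp (Tuple.sort p) p]
  exact Finset.sum_le_sum fun i _ => h.2 i

theorem IsParkingFunction.cast_parkingAreaNat {n : ℕ} {p : Fin n → ℕ} (h : IsParkingFunction p) :
    (parkingAreaNat p : ℝ) = parkingArea p := by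
  rw [parkingAreaNat, parkingArea, Nat.cast_sub h.sum_le, Nat.cast_choose_two]
  push_cast
  ring

/-- The zero-indexed values sum to (n choose 2) minus the area, so inverting the variable turns the
sum statistic into area. -/
theorem IsParkingFunction.pow_mul_prod {n : ℕ} {p : Fin n → ℕ} (h : IsParkingFunction p) {Q : ℝ}
    (hQ : Q ≠ 0) : Q ^ n.choose 2 * ∏ i, Q⁻¹ ^ (p i - 1) = Q ^ parkingAreaNat p := by
  rw [Finset.prod_pow_eq_pow_sum, inv_pow, mul_inv_eq_iff_eq_mul₀ (pow_ne_zero _ hQ), ← pow_add]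
  congr 1
  have h1 : ∑ i, (p i - 1) + n = ∑ i, p i := by
    have : ∑ i : Fin n, p i = ∑ i, ((p i - 1) + 1) :=
      Finset.sum_congr rfl fun i _ => (Nat.sub_add_cancel (h.1 i).1).symm
    rw [this, Finset.sum_add_distrib]
    simp
  have h2 := h.sum_le
  have h3 : (n + 1).choose 2 = n + n.choose 2 := by
    rw [Nat.choose_succ_succ' n 1, Nat.choose_one_right]
  unfold parkingAreaNat
  omega

/-- The enumerator of parking functions by area, evaluated at `Q`. -/
noncomputable def areaEnumerator (n : ℕ) (Q : ℝ) : ℝ :=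
  ∑ p ∈ parkingFunctions n, Q ^ parkingAreaNat p

theorem choose_two_add (k m : ℕ) :
    (k + m + 1).choose 2 = k.choose 2 + k + (k + 1) * m + m.choose 2 := by
  have : ((k + m + 1).choose 2 : ℚ) = k.choose 2 + k + (k + 1) * m + m.choose 2 := by
    simp only [Nat.cast_choose_two]
    push_cast
    ring
  exact_mod_cast this

theorem sum_choose_mul_areaEnumerator {Q : ℝ} (hQ : 1 < Q) (n : ℕ) :
    ∑ k ∈ Finset.range (n + 1), (n.choose k : ℝ) * (areaEnumerator k Q * (Q - 1) ^ k *
      Q ^ (n - k).choose 2) = Q ^ (n + 1).choose 2 := by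
  have hQ0 : Q ≠ 0 := by linarith
  have hQ1 : Q - 1 ≠ 0 := by linarith
  have hq1 : 1 - Q⁻¹ = (Q - 1) * Q⁻¹ := by field_simp
  have h := sum_choose_mul_parking_geometric (q := Q⁻¹) (by positivity) (inv_lt_one_of_one_lt₀ hQ) n
  -- This factor clears the denominators 1 - q and all negative powers of `Q`; `choose_two_add` then
  -- matches the exponents for n = k + m.
  have h' := congrArg (fun t => t * ((1 - Q⁻¹) ^ n * Q ^ (n + 1).choose 2)) h
  rw [Finset.sum_mul] at h'
  have hne : 1 - Q⁻¹ ≠ 0 := by rw [hq1]; positivity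
  rw [← mul_assoc, ← mul_pow, inv_mul_cancel₀ hne, one_pow, one_mul] at h'
  rw [← h']
  refine Finset.sum_congr rfl fun k hk => ?_
  obtain ⟨m, rfl⟩ := Nat.exists_eq_add_of_le (Nat.lt_succ_iff.1 (Finset.mem_range.1 hk))
  have hA : areaEnumerator k Q = Q ^ k.choose 2 *
      ∑ p ∈ parkingFunctions k, ∏ i, Q⁻¹ ^ (p i - 1) := by
    rw [areaEnumerator, Finset.mul_sum]
    exact Finset.sum_congr rfl fun p hp =>
      (((mem_parkingFunctions p).1 hp).pow_mul_prod hQ0).symm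
  rw [hA, Nat.add_sub_cancel_left, choose_two_add, hq1]
  generalize ∑ p ∈ parkingFunctions k, ∏ i, Q⁻¹ ^ (p i - 1) = P
  simp only [mul_pow, pow_add, pow_mul, inv_pow, mul_inv, inv_inv]
  field_simp

open PowerSeries in
theorem areaEnumerator_succ_of_one_lt {Q : ℝ} (hQ : 1 < Q) (n : ℕ) :
    (n + 1 : ℝ) * ((Q - 1) * (areaEnumerator (n + 1) Q / (n + 1).factorial)) =
      ∑ x ∈ Finset.HasAntidiagonal.antidiagonal n, areaEnumerator x.1 Q / x.1.factorial *
        (areaEnumerator x.2 Q / x.2.factorial * (Q ^ (x.2 + 1) - 1)) := by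
  have hy : Q - 1 ≠ 0 := by linarith
  set G : ℝ⟦X⟧ := mk fun n => Q ^ n.choose 2 / (n.factorial : ℝ) with hG
  set A : ℝ⟦X⟧ := mk fun n => areaEnumerator n Q / n.factorial * (Q - 1) ^ n with hA
  -- This is `sum_choose_mul_areaEnumerator` divided by `n!`. The extra Qⁿ of `rescale` turns n
  -- choose 2 into n + 1 choose 2.
  have hmul : A * G = rescale Q G := by
    ext n
    rw [coeff_mul, Finset.Nat.sum_antidiagonal_eq_sum_range_succ (fun i j => coeff i A * coeff j G),
      coeff_rescale, hG, coeff_mk, mul_div_assoc', ← pow_add]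
    have h1 : n + n.choose 2 = (n + 1).choose 2 := by
      rw [Nat.choose_succ_succ' n 1, Nat.choose_one_right]
    rw [h1, ← sum_choose_mul_areaEnumerator hQ n, Finset.sum_div]
    refine Finset.sum_congr rfl fun k hk => ?_
    rw [hA, coeff_mk, coeff_mk, Nat.cast_choose ℝ (Nat.lt_succ_iff.1 (Finset.mem_range.1 hk))]
    field_simp
  have hder : d⁄dX ℝ G = rescale Q G := by
    ext n
    rw [coeff_derivative, coeff_rescale, hG, coeff_mk, coeff_mk, Nat.choose_succ_succ' n 1,
      Nat.choose_one_right, pow_add, Nat.factorial_succ]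
    push_cast
    field_simp
  have hders : d⁄dX ℝ (rescale Q G) = C Q * (rescale Q A * rescale Q G) := by
    ext n
    have h1 := congrArg (coeff n) hder
    rw [coeff_derivative] at h1
    rw [← map_mul, hmul, coeff_derivative, coeff_rescale, coeff_C_mul, coeff_rescale, ← h1]
    ring
  have hG0 : G ≠ 0 := by
    intro h
    have := congrArg (coeff 0) h
    simp [hG] at this
  -- Differentiate A G = G(Qx), replace G' and G(Qx) by A G, and cancel G.
  have hA' : d⁄dX ℝ A = A * (C Q * rescale Q A - A) := by
    have h2 := congrArg (d⁄dX ℝ) hmul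
    rw [Derivation.leibniz, hders, smul_eq_mul, smul_eq_mul, hder, ← hmul] at h2
    refine mul_left_cancel₀ hG0 ?_
    linear_combination h2
  have h3 := congrArg (coeff n) hA'
  rw [coeff_derivative, coeff_mul, hA, coeff_mk] at h3
  -- The scaling of x by Q - 1 contributes (Q - 1)ⁿ to every term; one more factor Q - 1 stays on
  -- the left.
  refine mul_left_cancel₀ (pow_ne_zero n hy) ?_
  rw [Finset.mul_sum]
  calc _ = areaEnumerator (n + 1) Q / ((n + 1).factorial : ℝ) * (Q - 1) ^ (n + 1) * (n + 1) := by
        ring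
    _ = _ := h3
    _ = _ := by
        refine Finset.sum_congr rfl fun x hx => ?_
        rw [map_sub, coeff_C_mul, coeff_rescale, coeff_mk, coeff_mk,
          ← Finset.HasAntidiagonal.mem_antidiagonal.1 hx]
        ring

/-! ### Taylor expansion at Q = 1 -/

open Polynomial in
/-- The enumerator of parking functions by area in powers of `1 + X`, divided by `n!`. -/
noncomputable def areaPolynomial (n : ℕ) : ℝ[X] :=
  C ((n.factorial : ℝ)⁻¹) * ∑ p ∈ parkingFunctions n, (1 + X) ^ parkingAreaNat p

open Polynomial in
theorem eval_areaPolynomial (n : ℕ) (y : ℝ) :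
    (areaPolynomial n).eval y = areaEnumerator n (1 + y) / n.factorial := by
  simp only [areaPolynomial, areaEnumerator, eval_mul, eval_C, eval_finsetSum, eval_pow, eval_add,
    eval_one, eval_X]
  rw [mul_comm, div_eq_mul_inv]

-- The recurrence is known for every Q > 1, hence as an identity of polynomials in Q - 1.
open Polynomial in
theorem areaPolynomial_succ (n : ℕ) :
    (C (n + 1 : ℝ)) * areaPolynomial (n + 1) * X =
      ∑ x ∈ Finset.HasAntidiagonal.antidiagonal n, areaPolynomial x.1 *
        (areaPolynomial x.2 * ((1 + X) ^ (x.2 + 1) - 1)) := by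
  refine eq_of_infinite_eval_eq _ _ ((Set.Ioi_infinite (0 : ℝ)).mono fun y hy => ?_)
  have h := areaEnumerator_succ_of_one_lt (Q := 1 + y) (by simpa using hy) n
  simp only [Set.mem_ofPred_eq, eval_finsetSum, eval_mul, eval_C, eval_areaPolynomial, eval_X,
    eval_sub, eval_pow, eval_add, eval_one]
  rw [← h]
  ring

/-- The `j`-th Taylor coefficient at `1` of the area enumerator, divided by `n!`. -/
noncomputable def areaCoeff (j n : ℕ) : ℝ := (areaPolynomial n).coeff j

theorem areaCoeff_eq (j n : ℕ) :
    areaCoeff j n =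
      (n.factorial : ℝ)⁻¹ * ∑ p ∈ parkingFunctions n, ((parkingAreaNat p).choose j : ℝ) := by
  simp [areaCoeff, areaPolynomial, Polynomial.coeff_C_mul, Polynomial.coeff_one_add_X_pow]

/-- Order `j + 1` is compared because the left side of `areaPolynomial_succ` carries a factor `X`.
Subtracting 1 there removes the terms with `z.2 = 0`. -/
theorem areaCoeff_succ (j n : ℕ) :
    (n + 1 : ℝ) * areaCoeff j (n + 1) =
      ∑ x ∈ Finset.HasAntidiagonal.antidiagonal n, ∑ y ∈ Finset.HasAntidiagonal.antidiagonal (j +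
        1), areaCoeff y.1 x.1 *
        ∑ z ∈ Finset.HasAntidiagonal.antidiagonal y.2, areaCoeff z.1 x.2 *
          if z.2 = 0 then 0 else ((x.2 + 1).choose z.2 : ℝ) := by
  have h := congrArg (fun P => Polynomial.coeff P (j + 1)) (areaPolynomial_succ n)
  simp only [Polynomial.coeff_mul_X, Polynomial.coeff_C_mul, Polynomial.finsetSum_coeff] at h
  simp only [Polynomial.coeff_mul] at h
  rw [areaCoeff, h]
  refine Finset.sum_congr rfl fun x _ => Finset.sum_congr rfl fun y _ => ?_
  rw [areaCoeff]
  congr 1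
  refine Finset.sum_congr rfl fun z _ => ?_
  rw [areaCoeff, Polynomial.coeff_sub, Polynomial.coeff_one_add_X_pow, Polynomial.coeff_one]
  split_ifs with h0
  · simp [h0]
  · simp

/-! ### The Euler operator and its binomial analogues -/

namespace PowerSeries

/-- The Euler operator `X · d/dX`. -/
noncomputable def euler : Derivation ℝ ℝ⟦X⟧ ℝ⟦X⟧ := (X : ℝ⟦X⟧) • d⁄dX ℝ

theorem coeff_euler (f : ℝ⟦X⟧) (n : ℕ) : coeff n (euler f) = n * coeff n f := by
  rw [euler, Derivation.smul_apply, smul_eq_mul]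
  cases n with
  | zero => simp
  | succ n =>
    rw [coeff_succ_X_mul, coeff_derivative]
    push_cast
    ring

/-- The operator `Xᵐ / m! · (d/dX)ᵐ`. -/
noncomputable def binomialOp (m : ℕ) (f : ℝ⟦X⟧) : ℝ⟦X⟧ := mk fun n => (n.choose m : ℝ) * coeff n f

theorem coeff_binomialOp (m : ℕ) (f : ℝ⟦X⟧) (n : ℕ) :
    coeff n (binomialOp m f) = (n.choose m : ℝ) * coeff n f := coeff_mk _ _

theorem binomialOp_zero (f : ℝ⟦X⟧) : binomialOp 0 f = f := by
  ext n
  simp [coeff_binomialOp]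

theorem succ_mul_binomialOp_succ (m : ℕ) (f : ℝ⟦X⟧) :
    ((m : ℝ⟦X⟧) + 1) * binomialOp (m + 1) f = euler (binomialOp m f) - m * binomialOp m f := by
  ext n
  have h1 : ((m : ℝ⟦X⟧) + 1) = C (m + 1 : ℝ) := by simp
  have h2 : (m : ℝ⟦X⟧) = C (m : ℝ) := by simp
  rw [h1, map_sub, coeff_C_mul, coeff_euler, h2, coeff_C_mul]
  simp only [coeff_binomialOp]
  have h := Nat.choose_succ_right_eq n m
  have h3 : (n.choose (m + 1) : ℝ) * (m + 1) = n.choose m * ((n : ℝ) - m) := by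
    rcases le_or_gt m n with hmn | hmn
    · rw [← Nat.cast_sub hmn]
      exact_mod_cast h
    · rw [Nat.choose_eq_zero_of_lt hmn, Nat.choose_eq_zero_of_lt (by omega)]
      simp
  linear_combination coeff n f * h3

end PowerSeries

open PowerSeries

/-! ### Differential equations for the moment series -/

/-- `∑ₙ areaCoeff j n xⁿ⁺¹`. -/
noncomputable def areaSeries (j : ℕ) : ℝ⟦X⟧ := X * mk fun n => areaCoeff j n

theorem coeff_succ_areaSeries (j n : ℕ) : coeff (n + 1) (areaSeries j) = areaCoeff j n := by
  rw [areaSeries, coeff_succ_X_mul, coeff_mk]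

theorem coeff_zero_areaSeries (j : ℕ) : coeff 0 (areaSeries j) = 0 := by
  simp [areaSeries]

/-- The exponent shift in `areaSeries` makes the factor `(x.2 + 1).choose z.2` of the recurrence act
as `binomialOp z.2`. -/
theorem euler_areaSeries_sub (j : ℕ) :
    euler (areaSeries j) - areaSeries j =
      ∑ y ∈ Finset.HasAntidiagonal.antidiagonal (j + 1), areaSeries y.1 *
        ∑ z ∈ Finset.HasAntidiagonal.antidiagonal y.2, if z.2 = 0 then 0 else binomialOp z.2
          (areaSeries z.1) := by
  have hop : ∀ r m : ℕ, binomialOp m (areaSeries r) =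
      if m = 0 then areaSeries r else
      X * mk fun l => areaCoeff r l * ((l + 1).choose m : ℝ) := by
    intro r m
    split_ifs with h
    · rw [h, binomialOp_zero]
    ext n
    cases n with
    | zero => simp [coeff_binomialOp, coeff_zero_areaSeries]
    | succ n => rw [coeff_binomialOp, coeff_succ_areaSeries, coeff_succ_X_mul, coeff_mk, mul_comm]
  have hsum : (∑ y ∈ Finset.HasAntidiagonal.antidiagonal (j + 1), areaSeries y.1 *
        ∑ z ∈ Finset.HasAntidiagonal.antidiagonal y.2, if z.2 = 0 then 0 else binomialOp z.2
          (areaSeries z.1)) =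
      X * (X * ∑ y ∈ Finset.HasAntidiagonal.antidiagonal (j + 1), (mk fun n => areaCoeff y.1 n) *
        ∑ z ∈ Finset.HasAntidiagonal.antidiagonal y.2,
          mk fun l => areaCoeff z.1 l * if z.2 = 0 then 0 else ((l + 1).choose z.2 : ℝ)) := by
    simp only [Finset.mul_sum]
    refine Finset.sum_congr rfl fun y _ => Finset.sum_congr rfl fun z _ => ?_
    split_ifs with h
    · have : (mk fun l => areaCoeff z.1 l * (0 : ℝ)) = (0 : ℝ⟦X⟧) := by
        ext
        simp
      rw [this]
      ring
    · rw [hop, if_neg h, areaSeries]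
      ring
  rw [hsum]
  ext n
  rw [map_sub, coeff_euler]
  rcases n with _ | _ | n
  · simp [areaSeries]
  · rw [coeff_succ_X_mul]
    simp
  · rw [coeff_succ_X_mul, coeff_succ_X_mul, coeff_succ_areaSeries, map_sum]
    have h := areaCoeff_succ j n
    push_cast
    -- At exponent n + 2 the operator θ - 1 produces exactly the factor n + 1 of the recurrence.
    rw [show ((n : ℝ) + 1 + 1) * areaCoeff j (n + 1) - areaCoeff j (n + 1) =
      (n + 1) * areaCoeff j (n + 1) by ring, h, Finset.sum_comm]
    refine Finset.sum_congr rfl fun y _ => ?_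
    rw [coeff_mul]
    refine Finset.sum_congr rfl fun x _ => ?_
    rw [coeff_mk, map_sum]
    simp only [coeff_mk]

theorem parkingFunctions_zero_card : (parkingFunctions 0).card = 1 := by
  decide

theorem areaCoeff_zero_right (j : ℕ) : areaCoeff j 0 = if j = 0 then 1 else 0 := by
  have h : ∀ p ∈ parkingFunctions 0, ((parkingAreaNat p).choose j : ℝ) = if j = 0 then 1 else 0 :=
    by
    intro p _
    have : parkingAreaNat p = 0 := by simp [parkingAreaNat]
    rw [this]
    cases j <;> simp
  rw [areaCoeff_eq, Finset.sum_congr rfl h, Finset.sum_const, parkingFunctions_zero_card]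
  simp

theorem binomialOp_one (f : ℝ⟦X⟧) : binomialOp 1 f = euler f := by
  have h := succ_mul_binomialOp_succ 0 f
  rw [binomialOp_zero] at h
  simpa using h

theorem euler_areaSeries_zero :
    euler (areaSeries 0) - areaSeries 0 = areaSeries 0 * euler (areaSeries 0) := by
  rw [euler_areaSeries_sub]
  simp [Finset.Nat.antidiagonal_succ, binomialOp_one]

/-! ### Calculus of the tree series: W = 1 - T and Z = 1/W -/

/-- `1 - T`, for the tree series `T = areaSeries 0`. -/
noncomputable def treeW : ℝ⟦X⟧ := 1 - areaSeries 0

/-- `1 / (1 - T)`, for the tree series `T = areaSeries 0`. -/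
noncomputable def treeZ : ℝ⟦X⟧ := treeW⁻¹

theorem areaSeries_zero : areaSeries 0 = 1 - treeW := by
  rw [treeW]
  ring

theorem constantCoeff_treeW : constantCoeff treeW = 1 := by
  rw [treeW, map_sub, ← coeff_zero_eq_constantCoeff_apply (areaSeries 0), coeff_zero_areaSeries]
  simp

theorem treeW_mul_treeZ : treeW * treeZ = 1 :=
  PowerSeries.mul_inv_cancel _ (by rw [constantCoeff_treeW]; exact one_ne_zero)

theorem constantCoeff_treeZ : constantCoeff treeZ = 1 := by
  have := congrArg constantCoeff treeW_mul_treeZ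
  simpa [constantCoeff_treeW] using this

theorem euler_one : euler (1 : ℝ⟦X⟧) = 0 := Derivation.map_one_eq_zero _

theorem euler_treeW : euler treeW = 1 - treeZ := by
  have h := euler_areaSeries_zero
  rw [areaSeries_zero, map_sub, euler_one] at h
  linear_combination (-treeZ) * h + (-euler treeW + 1) * treeW_mul_treeZ

theorem euler_treeZ : euler treeZ = treeZ ^ 3 - treeZ ^ 2 := by
  have h := congrArg euler treeW_mul_treeZ
  rw [Derivation.leibniz, euler_one, smul_eq_mul, smul_eq_mul, euler_treeW] at h
  linear_combination treeZ * h - euler treeZ * treeW_mul_treeZ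

theorem euler_treeZ_pow (k : ℕ) :
    euler (treeZ ^ k) = k * (treeZ ^ (k + 2) - treeZ ^ (k + 1)) := by
  cases k with
  | zero => simp
  | succ k =>
    rw [Derivation.leibniz_pow, euler_treeZ, nsmul_eq_mul, smul_eq_mul, Nat.add_sub_cancel]
    ring

theorem euler_natCast_mul (a : ℕ) (f : ℝ⟦X⟧) : euler (a * f) = a * euler f := by
  rw [← nsmul_eq_mul, map_nsmul, nsmul_eq_mul]

theorem euler_ofNat_mul (a : ℕ) [a.AtLeastTwo] (f : ℝ⟦X⟧) :
    euler (ofNat(a) * f) = ofNat(a) * euler f :=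
  euler_natCast_mul a f

theorem euler_ofNat (a : ℕ) [a.AtLeastTwo] : euler (ofNat(a) : ℝ⟦X⟧) = 0 :=
  Derivation.map_natCast _ a

theorem coeff_ofNat_mul (a n : ℕ) [a.AtLeastTwo] (f : ℝ⟦X⟧) :
    coeff n (ofNat(a) * f) = ofNat(a) * coeff n f := by
  have : (ofNat(a) : ℝ⟦X⟧) = C (ofNat(a) : ℝ) := (map_ofNat _ a).symm
  rw [this, coeff_C_mul]

theorem coeff_one_ofNat (a : ℕ) [a.AtLeastTwo] : coeff 1 (ofNat(a) : ℝ⟦X⟧) = 0 := by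
  have : (ofNat(a) : ℝ⟦X⟧) = C (ofNat(a) : ℝ) := (map_ofNat _ a).symm
  rw [this, coeff_C]
  simp

theorem coeff_one_treeW : coeff 1 treeW = -1 := by
  rw [treeW, map_sub, coeff_succ_areaSeries, areaCoeff_zero_right]
  simp [coeff_one]

theorem coeff_one_treeZ : coeff 1 treeZ = 1 := by
  have h := congrArg (coeff 1) treeW_mul_treeZ
  simp only [coeff_mul, Finset.Nat.antidiagonal_succ] at h
  simp [coeff_one_treeW, constantCoeff_treeW, constantCoeff_treeZ, coeff_one] at h
  linarith

theorem coeff_one_treeZ_pow (k : ℕ) : coeff 1 (treeZ ^ k) = k := by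
  rw [coeff_one_pow, coeff_one_treeZ, constantCoeff_treeZ]
  simp

/-- Computes the successive `binomialOp` normal forms while keeping integer coefficients: the
denominator goes into the multiplier `a`. -/
theorem binomialOp_succ_of_eq {a m : ℕ} {f N : ℝ⟦X⟧} (h : (a : ℝ⟦X⟧) * binomialOp m f = N) :
    ((a * (m + 1) : ℕ) : ℝ⟦X⟧) * binomialOp (m + 1) f = euler N - m * N := by
  have h1 := succ_mul_binomialOp_succ m f
  rw [← h, euler_natCast_mul]
  push_cast
  linear_combination a * h1

/-- As Z² has constant term 1, the coefficient of xⁿ gives (n - 1) yₙ in terms of lower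
coefficients. Only y₁ is free, so a candidate closed form need only be checked in the equation and
at x¹. -/
theorem eq_zero_of_euler_eq {Y : ℝ⟦X⟧} (h : euler Y = treeZ ^ 2 * Y) (h1 : coeff 1 Y = 0) :
    Y = 0 := by
  ext n
  induction n using Nat.strong_induction_on with
  | _ n ih =>
    have hn := congrArg (coeff n) h
    rw [coeff_euler, coeff_mul] at hn
    have hz : ∑ x ∈ Finset.HasAntidiagonal.antidiagonal n, coeff x.1 (treeZ ^ 2) * coeff x.2 Y =
        coeff n Y := by
      rw [Finset.sum_eq_single (0, n)]
      · simp [constantCoeff_treeZ]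
      · rintro ⟨a, b⟩ hab hne
        rw [Finset.HasAntidiagonal.mem_antidiagonal] at hab
        simp only at hab ⊢
        have : b < n := by
          rcases Nat.eq_zero_or_pos a with rfl | ha
          · exact absurd (by simp_all) hne
          · omega
        rw [ih b this]
        simp
      · simp
    rw [hz] at hn
    rcases eq_or_ne n 1 with rfl | hn1
    · simpa using h1
    · have : (n : ℝ) - 1 ≠ 0 := sub_ne_zero.2 (by exact_mod_cast hn1)
      have h2 : ((n : ℝ) - 1) * coeff n Y = 0 := by linear_combination hn
      simpa using (mul_eq_zero.1 h2).resolve_left this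

/-! ### Closed forms of `areaSeries 1` to `areaSeries 4` -/

set_option linter.unusedSimpArgs false

theorem mul_binomialOp_one_areaSeries_zero :
    binomialOp 1 (areaSeries 0) =
      treeZ - 1 := by
  have h := congrArg euler areaSeries_zero
  simp only [map_add, map_sub, map_neg, euler_ofNat_mul, euler_ofNat, euler_one, euler_treeZ_pow,
    euler_treeZ, euler_treeW, Nat.cast_ofNat] at h
  rw [binomialOp_one]
  linear_combination h

theorem mul_binomialOp_two_areaSeries_zero :
    2 * binomialOp 2 (areaSeries 0) =
      1 - treeZ - treeZ ^ 2 + treeZ ^ 3 := by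
  have h := binomialOp_succ_of_eq (a := 1) (m := 1) (f := areaSeries 0)
    (Eq.trans (by rw [Nat.cast_one, one_mul]) mul_binomialOp_one_areaSeries_zero)
  simp only [map_add, map_sub, map_neg, euler_ofNat_mul, euler_ofNat, euler_one, euler_treeZ_pow,
    euler_treeZ, euler_treeW, Nat.cast_ofNat] at h
  push_cast at h
  linear_combination h

theorem mul_areaSeries_one :
    2 * areaSeries 1 =
      3 - 3 * treeZ + treeZ ^ 2 - treeW := by
  have hS : euler (areaSeries 1) - areaSeries 1 =
      areaSeries 0 * euler (areaSeries 1) + areaSeries 1 * binomialOp 1 (areaSeries 0) +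
      areaSeries 0 * binomialOp 2 (areaSeries 0) := by
    rw [euler_areaSeries_sub, ← binomialOp_one]
    simp [Finset.Nat.antidiagonal_succ]
    ring
  -- Products are brought to normal form, linear in W and polynomial in Z, by W Z = 1.
  have h1 : 2 * (areaSeries 0 * binomialOp 2 (areaSeries 0)) =
      2 - 2 * treeZ ^ 2 + treeZ ^ 3 - treeW := by
    linear_combination 2 * binomialOp 2 (areaSeries 0) * areaSeries_zero +
      (1 - treeW) *
        mul_binomialOp_two_areaSeries_zero +
      (1 + treeZ - treeZ ^ 2) * treeW_mul_treeZ
  -- Multiplying the equation by Z turns (1 - T) θS = Z S + … into θS = Z² S + …; the difference of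
  -- the two sides therefore solves the homogeneous equation.
  refine sub_eq_zero.1 (eq_zero_of_euler_eq ?_ ?_)
  · simp only [map_add, map_sub, map_neg, euler_ofNat_mul, euler_ofNat, euler_one, euler_treeZ_pow,
      euler_treeZ, euler_treeW, Nat.cast_ofNat]
    linear_combination 2 * treeZ * hS + treeZ * h1 + 2 * treeZ * euler (areaSeries 1) *
      areaSeries_zero + 2 * treeZ
      * areaSeries 1 * mul_binomialOp_one_areaSeries_zero + (-2 * euler (areaSeries 1) - 1 * treeZ
        - 1) *
      treeW_mul_treeZ
  -- The x¹ coefficient of the series is `areaCoeff 1 0`, which vanishes because the empty parking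
  -- function has area 0.
  · simp only [map_add, map_sub, map_neg, coeff_ofNat_mul, coeff_one_ofNat, coeff_one,
      coeff_one_treeZ_pow,
      coeff_one_treeZ, coeff_one_treeW,
      coeff_succ_areaSeries, areaCoeff_zero_right]
    norm_num

theorem mul_binomialOp_one_areaSeries_one :
    2 * binomialOp 1 (areaSeries 1) =
      treeZ - 1 + 3 * treeZ ^ 2 - 5 * treeZ ^ 3 + 2 * treeZ ^ 4 := by
  have h := congrArg euler mul_areaSeries_one
  simp only [map_add, map_sub, map_neg, euler_ofNat_mul, euler_ofNat, euler_one, euler_treeZ_pow,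
    euler_treeZ, euler_treeW, Nat.cast_ofNat] at h
  rw [binomialOp_one]
  linear_combination h

theorem mul_binomialOp_three_areaSeries_zero :
    6 * binomialOp 3 (areaSeries 0) =
      2 * treeZ - 2 + 3 * treeZ ^ 2 - treeZ ^ 3 - 5 * treeZ ^ 4 + 3 * treeZ ^ 5 := by
  have h := binomialOp_succ_of_eq (a := 2) (m := 2) (f := areaSeries 0)
    (Eq.trans (by rw [Nat.cast_ofNat]) mul_binomialOp_two_areaSeries_zero)
  simp only [map_add, map_sub, map_neg, euler_ofNat_mul, euler_ofNat, euler_one, euler_treeZ_pow,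
    euler_treeZ, euler_treeW, Nat.cast_ofNat] at h
  push_cast at h
  linear_combination h

theorem mul_binomialOp_two_areaSeries_one :
    4 * binomialOp 2 (areaSeries 1) =
      1 - treeZ - 4 * treeZ ^ 2 + 19 * treeZ ^ 4 - 23 * treeZ ^ 5 + 8 * treeZ ^ 6 := by
  have h := binomialOp_succ_of_eq (a := 2) (m := 1) (f := areaSeries 1)
    (Eq.trans (by rw [Nat.cast_ofNat]) mul_binomialOp_one_areaSeries_one)
  simp only [map_add, map_sub, map_neg, euler_ofNat_mul, euler_ofNat, euler_one, euler_treeZ_pow,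
    euler_treeZ, euler_treeW, Nat.cast_ofNat] at h
  push_cast at h
  linear_combination h

theorem mul_areaSeries_two :
    24 * areaSeries 2 =
      64 * treeZ ^ 3 - 1 - treeZ - 26 * treeZ ^ 2 - 53 * treeZ ^ 4 + 15 * treeZ ^ 5 + 2 * treeW :=
        by
  have hS : euler (areaSeries 2) - areaSeries 2 =
      areaSeries 0 * euler (areaSeries 2) + areaSeries 2 * binomialOp 1 (areaSeries 0) +
      areaSeries 0 * binomialOp 3 (areaSeries 0) + areaSeries 0 * binomialOp 2 (areaSeries 1) +
      areaSeries 1 * binomialOp 2 (areaSeries 0) + areaSeries 1 * binomialOp 1 (areaSeries 1) := by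
    rw [euler_areaSeries_sub, ← binomialOp_one]
    simp [Finset.Nat.antidiagonal_succ]
    ring
  have h1 : 6 * (areaSeries 0 * binomialOp 3 (areaSeries 0)) =
      4 * treeZ ^ 2 - 4 - treeZ + 4 * treeZ ^ 3 - 8 * treeZ ^ 4 + 3 * treeZ ^ 5 + 2 * treeW := by
    linear_combination 6 * binomialOp 3 (areaSeries 0) * areaSeries_zero +
      (1 - treeW) *
        mul_binomialOp_three_areaSeries_zero +
      (treeZ ^ 2 - 2 - 3 * treeZ + 5 * treeZ ^ 3 - 3 * treeZ ^ 4) * treeW_mul_treeZ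
  have h2 : 4 * (areaSeries 0 * binomialOp 2 (areaSeries 1)) =
      2 + 3 * treeZ - 4 * treeZ ^ 2 - 19 * treeZ ^ 3 + 42 * treeZ ^ 4 - 31 * treeZ ^ 5 + 8 * treeZ
      ^ 6 - treeW := by
    linear_combination 4 * binomialOp 2 (areaSeries 1) * areaSeries_zero +
      (1 - treeW) *
        mul_binomialOp_two_areaSeries_one +
      (1 + 4 * treeZ - 19 * treeZ ^ 3 + 23 * treeZ ^ 4 - 8 * treeZ ^ 5) * treeW_mul_treeZ
  have h3 : 4 * (areaSeries 1 * binomialOp 2 (areaSeries 0)) =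
      4 - 5 * treeZ + 5 * treeZ ^ 3 - 4 * treeZ ^ 4 + treeZ ^ 5 - treeW := by
    linear_combination 2 * binomialOp 2 (areaSeries 0) * mul_areaSeries_one +
      (3 - 3 * treeZ + treeZ ^ 2 - treeW) *
        mul_binomialOp_two_areaSeries_zero +
      (1 + treeZ - treeZ ^ 2) * treeW_mul_treeZ
  have h4 : 4 * (areaSeries 1 * binomialOp 1 (areaSeries 1)) =
      3 * treeZ - 4 + 10 * treeZ ^ 2 - 25 * treeZ ^ 3 + 24 * treeZ ^ 4 - 11 * treeZ ^ 5 + 2 *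
      treeZ ^ 6 + treeW := by
    linear_combination 2 * binomialOp 1 (areaSeries 1) * mul_areaSeries_one +
      (3 - 3 * treeZ + treeZ ^ 2 - treeW) *
        mul_binomialOp_one_areaSeries_one +
      (5 * treeZ ^ 2 - 1 - 3 * treeZ - 2 * treeZ ^ 3) * treeW_mul_treeZ
  refine sub_eq_zero.1 (eq_zero_of_euler_eq ?_ ?_)
  · simp only [map_add, map_sub, map_neg, euler_ofNat_mul, euler_ofNat, euler_one, euler_treeZ_pow,
      euler_treeZ, euler_treeW, Nat.cast_ofNat]
    linear_combination 24 * treeZ * hS + 4 * treeZ * h1 + 6 * treeZ * h2 + 6 * treeZ * h3 + 6 *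
      treeZ * h4 + 24 *
      treeZ * euler (areaSeries 2) * areaSeries_zero + 24 * treeZ * areaSeries 2 *
      mul_binomialOp_one_areaSeries_zero + (-24 * euler (areaSeries 2) + 2 * treeZ + 2) *
        treeW_mul_treeZ
  · simp only [map_add, map_sub, map_neg, coeff_ofNat_mul, coeff_one_ofNat, coeff_one,
      coeff_one_treeZ_pow,
      coeff_one_treeZ, coeff_one_treeW,
      coeff_succ_areaSeries, areaCoeff_zero_right]
    norm_num

theorem mul_binomialOp_one_areaSeries_two :
    24 * binomialOp 1 (areaSeries 2) =
      2 - 2 * treeZ + treeZ ^ 2 + 51 * treeZ ^ 3 - 244 * treeZ ^ 4 + 404 * treeZ ^ 5 - 287 * treeZ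
      ^ 6 + 75 * treeZ ^ 7 := by
  have h := congrArg euler mul_areaSeries_two
  simp only [map_add, map_sub, map_neg, euler_ofNat_mul, euler_ofNat, euler_one, euler_treeZ_pow,
    euler_treeZ, euler_treeW, Nat.cast_ofNat] at h
  rw [binomialOp_one]
  linear_combination h

theorem mul_binomialOp_four_areaSeries_zero :
    24 * binomialOp 4 (areaSeries 0) =
      6 - 6 * treeZ - 11 * treeZ ^ 2 - treeZ ^ 3 + 24 * treeZ ^ 4 + 8 * treeZ ^ 5 - 35 * treeZ ^ 6
      + 15 * treeZ ^ 7 := by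
  have h := binomialOp_succ_of_eq (a := 6) (m := 3) (f := areaSeries 0)
    (Eq.trans (by rw [Nat.cast_ofNat]) mul_binomialOp_three_areaSeries_zero)
  simp only [map_add, map_sub, map_neg, euler_ofNat_mul, euler_ofNat, euler_one, euler_treeZ_pow,
    euler_treeZ, euler_treeW, Nat.cast_ofNat] at h
  push_cast at h
  linear_combination h

theorem mul_binomialOp_three_areaSeries_one :
    12 * binomialOp 3 (areaSeries 1) =
      2 * treeZ - 2 + 9 * treeZ ^ 2 + 7 * treeZ ^ 3 - 46 * treeZ ^ 4 - 30 * treeZ ^ 5 + 175 *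
      treeZ ^ 6 - 163 * treeZ ^ 7 + 48 * treeZ ^ 8 := by
  have h := binomialOp_succ_of_eq (a := 4) (m := 2) (f := areaSeries 1)
    (Eq.trans (by rw [Nat.cast_ofNat]) mul_binomialOp_two_areaSeries_one)
  simp only [map_add, map_sub, map_neg, euler_ofNat_mul, euler_ofNat, euler_one, euler_treeZ_pow,
    euler_treeZ, euler_treeW, Nat.cast_ofNat] at h
  push_cast at h
  linear_combination h

theorem mul_binomialOp_two_areaSeries_two :
    48 * binomialOp 2 (areaSeries 2) =
      2 * treeZ - 2 + treeZ ^ 2 - 55 * treeZ ^ 3 + 93 * treeZ ^ 4 + 725 * treeZ ^ 5 - 2709 * treeZ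
      ^ 6 + 3667 * treeZ ^ 7 - 2247 * treeZ ^ 8 + 525 * treeZ ^ 9 := by
  have h := binomialOp_succ_of_eq (a := 24) (m := 1) (f := areaSeries 2)
    (Eq.trans (by rw [Nat.cast_ofNat]) mul_binomialOp_one_areaSeries_two)
  simp only [map_add, map_sub, map_neg, euler_ofNat_mul, euler_ofNat, euler_one, euler_treeZ_pow,
    euler_treeZ, euler_treeW, Nat.cast_ofNat] at h
  push_cast at h
  linear_combination h

theorem mul_areaSeries_three :
    48 * areaSeries 3 =
      1 + treeZ + 23 * treeZ ^ 2 - 107 * treeZ ^ 3 + 345 * treeZ ^ 4 - 693 * treeZ ^ 5 + 757 *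
      treeZ ^ 6 - 415 * treeZ ^ 7 + 90 * treeZ ^ 8 - 2 * treeW := by
  have hS : euler (areaSeries 3) - areaSeries 3 =
      areaSeries 0 * euler (areaSeries 3) + areaSeries 3 * binomialOp 1 (areaSeries 0) +
      areaSeries 0 * binomialOp 4 (areaSeries 0) + areaSeries 0 * binomialOp 3 (areaSeries 1) +
      areaSeries 0 * binomialOp 2 (areaSeries 2) + areaSeries 1 * binomialOp 3 (areaSeries 0) +
      areaSeries 1 * binomialOp 2 (areaSeries 1) + areaSeries 1 * binomialOp 1 (areaSeries 2) +
      areaSeries 2 * binomialOp 2 (areaSeries 0) + areaSeries 2 * binomialOp 1 (areaSeries 1) := by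
    rw [euler_areaSeries_sub, ← binomialOp_one]
    simp [Finset.Nat.antidiagonal_succ]
    ring
  have h1 : 24 * (areaSeries 0 * binomialOp 4 (areaSeries 0)) =
      12 + 5 * treeZ - 10 * treeZ ^ 2 - 25 * treeZ ^ 3 + 16 * treeZ ^ 4 + 43 * treeZ ^ 5 - 50 *
      treeZ ^ 6 + 15 * treeZ ^ 7 - 6 * treeW := by
    linear_combination 24 * binomialOp 4 (areaSeries 0) * areaSeries_zero +
      (1 - treeW) *
        mul_binomialOp_four_areaSeries_zero +
      (6 + 11 * treeZ + treeZ ^ 2 - 24 * treeZ ^ 3 - 8 * treeZ ^ 4 + 35 * treeZ ^ 5 - 15 * treeZ ^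
      6) * treeW_mul_treeZ
  have h2 : 12 * (areaSeries 0 * binomialOp 3 (areaSeries 1)) =
      2 * treeZ ^ 2 - 4 - 7 * treeZ + 53 * treeZ ^ 3 - 16 * treeZ ^ 4 - 205 * treeZ ^ 5 + 338 *
      treeZ ^ 6 - 211 * treeZ ^ 7 + 48 * treeZ ^ 8 + 2 * treeW := by
    linear_combination 12 * binomialOp 3 (areaSeries 1) * areaSeries_zero +
      (1 - treeW) *
        mul_binomialOp_three_areaSeries_one +
      (46 * treeZ ^ 3 - 2 - 9 * treeZ - 7 * treeZ ^ 2 + 30 * treeZ ^ 4 - 175 * treeZ ^ 5 + 163 *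
      treeZ ^ 6 - 48 * treeZ ^ 7) * treeW_mul_treeZ
  have h3 : 48 * (areaSeries 0 * binomialOp 2 (areaSeries 2)) =
      treeZ - 4 + 56 * treeZ ^ 2 - 148 * treeZ ^ 3 - 632 * treeZ ^ 4 + 3434 * treeZ ^ 5 - 6376 *
      treeZ ^ 6 + 5914 * treeZ ^ 7 - 2772 * treeZ ^ 8 + 525 * treeZ ^ 9 + 2 * treeW := by
    linear_combination 48 * binomialOp 2 (areaSeries 2) * areaSeries_zero +
      (1 - treeW) *
        mul_binomialOp_two_areaSeries_two +
      (55 * treeZ ^ 2 - 2 - treeZ - 93 * treeZ ^ 3 - 725 * treeZ ^ 4 + 2709 * treeZ ^ 5 - 3667 *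
      treeZ ^ 6 + 2247 * treeZ ^ 7 - 525 * treeZ ^ 8) * treeW_mul_treeZ
  have h4 : 12 * (areaSeries 1 * binomialOp 3 (areaSeries 0)) =
      9 * treeZ - 8 + 2 * treeZ ^ 2 - 5 * treeZ ^ 3 - 12 * treeZ ^ 4 + 23 * treeZ ^ 5 - 14 * treeZ
      ^ 6 + 3 * treeZ ^ 7 + 2 * treeW := by
    linear_combination 6 * binomialOp 3 (areaSeries 0) * mul_areaSeries_one +
      (3 - 3 * treeZ + treeZ ^ 2 - treeW) *
        mul_binomialOp_three_areaSeries_zero +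
      (treeZ ^ 2 - 2 - 3 * treeZ + 5 * treeZ ^ 3 - 3 * treeZ ^ 4) * treeW_mul_treeZ
  have h5 : 8 * (areaSeries 1 * binomialOp 2 (areaSeries 1)) =
      4 - 2 * treeZ - 8 * treeZ ^ 2 - 8 * treeZ ^ 3 + 76 * treeZ ^ 4 - 134 * treeZ ^ 5 + 112 *
      treeZ ^ 6 - 47 * treeZ ^ 7 + 8 * treeZ ^ 8 - treeW := by
    linear_combination 4 * binomialOp 2 (areaSeries 1) * mul_areaSeries_one +
      (3 - 3 * treeZ + treeZ ^ 2 - treeW) *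
        mul_binomialOp_two_areaSeries_one +
      (1 + 4 * treeZ - 19 * treeZ ^ 3 + 23 * treeZ ^ 4 - 8 * treeZ ^ 5) * treeW_mul_treeZ
  have h6 : 48 * (areaSeries 1 * binomialOp 1 (areaSeries 2)) =
      8 - 13 * treeZ - 40 * treeZ ^ 2 + 392 * treeZ ^ 3 - 1288 * treeZ ^ 4 + 2282 * treeZ ^ 5 -
      2392 * treeZ ^ 6 + 1490 * treeZ ^ 7 - 512 * treeZ ^ 8 + 75 * treeZ ^ 9 - 2 * treeW := by
    linear_combination 24 * binomialOp 1 (areaSeries 2) * mul_areaSeries_one +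
      (3 - 3 * treeZ + treeZ ^ 2 - treeW) *
        mul_binomialOp_one_areaSeries_two +
      (2 - treeZ - 51 * treeZ ^ 2 + 244 * treeZ ^ 3 - 404 * treeZ ^ 4 + 287 * treeZ ^ 5 - 75 *
      treeZ ^ 6) * treeW_mul_treeZ
  have h7 : 48 * (areaSeries 2 * binomialOp 2 (areaSeries 0)) =
      90 * treeZ ^ 3 - 3 - 2 * treeZ - 22 * treeZ ^ 2 - 92 * treeZ ^ 4 - 22 * treeZ ^ 5 + 102 *
      treeZ ^ 6 - 68 * treeZ ^ 7 + 15 * treeZ ^ 8 + 2 * treeW := by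
    linear_combination 2 * binomialOp 2 (areaSeries 0) * mul_areaSeries_two +
      (64 * treeZ ^ 3 - 1 - treeZ - 26 * treeZ ^ 2 - 53 * treeZ ^ 4 + 15 * treeZ ^ 5 + 2 * treeW) *
        mul_binomialOp_two_areaSeries_zero +
      (2 * treeZ ^ 2 - 2 - 2 * treeZ) * treeW_mul_treeZ
  have h8 : 48 * (areaSeries 2 * binomialOp 1 (areaSeries 1)) =
      3 + 6 * treeZ + 12 * treeZ ^ 2 - 84 * treeZ ^ 3 + 42 * treeZ ^ 4 + 252 * treeZ ^ 5 - 516 *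
      treeZ ^ 6 + 438 * treeZ ^ 7 - 181 * treeZ ^ 8 + 30 * treeZ ^ 9 - 2 * treeW := by
    linear_combination 2 * binomialOp 1 (areaSeries 1) * mul_areaSeries_two +
      (64 * treeZ ^ 3 - 1 - treeZ - 26 * treeZ ^ 2 - 53 * treeZ ^ 4 + 15 * treeZ ^ 5 + 2 * treeW) *
        mul_binomialOp_one_areaSeries_one +
      (2 + 6 * treeZ - 10 * treeZ ^ 2 + 4 * treeZ ^ 3) * treeW_mul_treeZ
  refine sub_eq_zero.1 (eq_zero_of_euler_eq ?_ ?_)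
  · simp only [map_add, map_sub, map_neg, euler_ofNat_mul, euler_ofNat, euler_one, euler_treeZ_pow,
      euler_treeZ, euler_treeW, Nat.cast_ofNat]
    linear_combination 48 * treeZ * hS + 2 * treeZ * h1 + 4 * treeZ * h2 + treeZ * h3 + 4 * treeZ *
      h4 + 6 * treeZ
      * h5 + treeZ * h6 + treeZ * h7 + treeZ * h8 + 48 * treeZ * euler (areaSeries 3) *
      areaSeries_zero + 48 * treeZ * areaSeries 3 * mul_binomialOp_one_areaSeries_zero + (-48 *
        euler
      (areaSeries 3) - 2 * treeZ - 2) * treeW_mul_treeZ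
  · simp only [map_add, map_sub, map_neg, coeff_ofNat_mul, coeff_one_ofNat, coeff_one,
      coeff_one_treeZ_pow,
      coeff_one_treeZ, coeff_one_treeW,
      coeff_succ_areaSeries, areaCoeff_zero_right]
    norm_num

theorem mul_binomialOp_one_areaSeries_three :
    48 * binomialOp 1 (areaSeries 3) =
      2 * treeZ - 2 - treeZ ^ 2 - 45 * treeZ ^ 3 + 367 * treeZ ^ 4 - 1701 * treeZ ^ 5 + 4845 *
      treeZ ^ 6 - 8007 * treeZ ^ 7 + 7447 * treeZ ^ 8 - 3625 * treeZ ^ 9 + 720 * treeZ ^ 10 := by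
  have h := congrArg euler mul_areaSeries_three
  simp only [map_add, map_sub, map_neg, euler_ofNat_mul, euler_ofNat, euler_one, euler_treeZ_pow,
    euler_treeZ, euler_treeW, Nat.cast_ofNat] at h
  rw [binomialOp_one]
  linear_combination h

theorem mul_binomialOp_five_areaSeries_zero :
    120 * binomialOp 5 (areaSeries 0) =
      24 * treeZ - 24 + 50 * treeZ ^ 2 + 20 * treeZ ^ 3 - 115 * treeZ ^ 4 - 131 * treeZ ^ 5 + 196
      * treeZ ^ 6 + 190 * treeZ ^ 7 - 315 * treeZ ^ 8 + 105 * treeZ ^ 9 := by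
  have h := binomialOp_succ_of_eq (a := 24) (m := 4) (f := areaSeries 0)
    (Eq.trans (by rw [Nat.cast_ofNat]) mul_binomialOp_four_areaSeries_zero)
  simp only [map_add, map_sub, map_neg, euler_ofNat_mul, euler_ofNat, euler_one, euler_treeZ_pow,
    euler_treeZ, euler_treeW, Nat.cast_ofNat] at h
  push_cast at h
  linear_combination h

theorem mul_binomialOp_four_areaSeries_one :
    48 * binomialOp 4 (areaSeries 1) =
      6 - 6 * treeZ - 29 * treeZ ^ 2 - 37 * treeZ ^ 3 + 135 * treeZ ^ 4 + 295 * treeZ ^ 5 - 559 *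
      treeZ ^ 6 - 711 * treeZ ^ 7 + 2047 * treeZ ^ 8 - 1525 * treeZ ^ 9 + 384 * treeZ ^ 10 := by
  have h := binomialOp_succ_of_eq (a := 12) (m := 3) (f := areaSeries 1)
    (Eq.trans (by rw [Nat.cast_ofNat]) mul_binomialOp_three_areaSeries_one)
  simp only [map_add, map_sub, map_neg, euler_ofNat_mul, euler_ofNat, euler_one, euler_treeZ_pow,
    euler_treeZ, euler_treeW, Nat.cast_ofNat] at h
  push_cast at h
  linear_combination h

theorem mul_binomialOp_three_areaSeries_two :
    144 * binomialOp 3 (areaSeries 2) =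
      4 - 4 * treeZ - 4 * treeZ ^ 2 + 110 * treeZ ^ 3 - 19 * treeZ ^ 4 - 1987 * treeZ ^ 5 + 2165 *
      treeZ ^ 6 + 12545 * treeZ ^ 7 - 37429 * treeZ ^ 8 + 42595 * treeZ ^ 9 - 22701 * treeZ ^ 10 +
      4725 * treeZ ^ 11 := by
  have h := binomialOp_succ_of_eq (a := 48) (m := 2) (f := areaSeries 2)
    (Eq.trans (by rw [Nat.cast_ofNat]) mul_binomialOp_two_areaSeries_two)
  simp only [map_add, map_sub, map_neg, euler_ofNat_mul, euler_ofNat, euler_one, euler_treeZ_pow,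
    euler_treeZ, euler_treeW, Nat.cast_ofNat] at h
  push_cast at h
  linear_combination h

theorem mul_binomialOp_two_areaSeries_three :
    96 * binomialOp 2 (areaSeries 3) =
      2 - 2 * treeZ - treeZ ^ 2 + 49 * treeZ ^ 3 - 234 * treeZ ^ 4 + 98 * treeZ ^ 5 + 5128 * treeZ
      ^ 6 - 29568 * treeZ ^ 7 + 77672 * treeZ ^ 8 - 112000 * treeZ ^ 9 + 91481 * treeZ ^ 10 -
      39825 * treeZ ^ 11 + 7200 * treeZ ^ 12 := by
  have h := binomialOp_succ_of_eq (a := 48) (m := 1) (f := areaSeries 3)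
    (Eq.trans (by rw [Nat.cast_ofNat]) mul_binomialOp_one_areaSeries_three)
  simp only [map_add, map_sub, map_neg, euler_ofNat_mul, euler_ofNat, euler_one, euler_treeZ_pow,
    euler_treeZ, euler_treeW, Nat.cast_ofNat] at h
  push_cast at h
  linear_combination h

theorem mul_areaSeries_four :
    5760 * areaSeries 4 =
      9765 * treeZ ^ 3 - 74 - 78 * treeZ - 1725 * treeZ ^ 2 - 42552 * treeZ ^ 4 + 144024 * treeZ ^
      5 - 377382 * treeZ ^ 6 + 715230 * treeZ ^ 7 - 892070 * treeZ ^ 8 + 678110 * treeZ ^ 9 -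
      283125 * treeZ ^ 10 + 49725 * treeZ ^ 11 + 152 * treeW := by
  have hS : euler (areaSeries 4) - areaSeries 4 =
      areaSeries 0 * euler (areaSeries 4) + areaSeries 4 * binomialOp 1 (areaSeries 0) +
      areaSeries 0 * binomialOp 5 (areaSeries 0) + areaSeries 0 * binomialOp 4 (areaSeries 1) +
      areaSeries 0 * binomialOp 3 (areaSeries 2) + areaSeries 0 * binomialOp 2 (areaSeries 3) +
      areaSeries 1 * binomialOp 4 (areaSeries 0) + areaSeries 1 * binomialOp 3 (areaSeries 1) +
      areaSeries 1 * binomialOp 2 (areaSeries 2) + areaSeries 1 * binomialOp 1 (areaSeries 3) +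
      areaSeries 2 * binomialOp 3 (areaSeries 0) + areaSeries 2 * binomialOp 2 (areaSeries 1) +
      areaSeries 2 * binomialOp 1 (areaSeries 2) + areaSeries 3 * binomialOp 2 (areaSeries 0) +
      areaSeries 3 * binomialOp 1 (areaSeries 1) := by
    rw [euler_areaSeries_sub, ← binomialOp_one]
    simp [Finset.Nat.antidiagonal_succ]
    ring
  -- The thirteen products free of `areaSeries 4` form the inhomogeneous part; the two remaining
  -- terms yield the factor Z².
  have h1 : 120 * (areaSeries 0 * binomialOp 5 (areaSeries 0)) =
      30 * treeZ ^ 2 - 48 - 26 * treeZ + 135 * treeZ ^ 3 + 16 * treeZ ^ 4 - 327 * treeZ ^ 5 + 6 *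
      treeZ ^ 6 + 505 * treeZ ^ 7 - 420 * treeZ ^ 8 + 105 * treeZ ^ 9 + 24 * treeW := by
    linear_combination 120 * binomialOp 5 (areaSeries 0) * areaSeries_zero +
      (1 - treeW) *
        mul_binomialOp_five_areaSeries_zero +
      (115 * treeZ ^ 3 - 24 - 50 * treeZ - 20 * treeZ ^ 2 + 131 * treeZ ^ 4 - 196 * treeZ ^ 5 - 190
      * treeZ ^ 6 + 315 * treeZ ^ 7 - 105 * treeZ ^ 8) * treeW_mul_treeZ
  have h2 : 48 * (areaSeries 0 * binomialOp 4 (areaSeries 1)) =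
      12 + 23 * treeZ + 8 * treeZ ^ 2 - 172 * treeZ ^ 3 - 160 * treeZ ^ 4 + 854 * treeZ ^ 5 + 152
      * treeZ ^ 6 - 2758 * treeZ ^ 7 + 3572 * treeZ ^ 8 - 1909 * treeZ ^ 9 + 384 * treeZ ^ 10 - 6
      * treeW := by
    linear_combination 48 * binomialOp 4 (areaSeries 1) * areaSeries_zero +
      (1 - treeW) *
        mul_binomialOp_four_areaSeries_one +
      (6 + 29 * treeZ + 37 * treeZ ^ 2 - 135 * treeZ ^ 3 - 295 * treeZ ^ 4 + 559 * treeZ ^ 5 + 711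
      * treeZ ^ 6 - 2047 * treeZ ^ 7 + 1525 * treeZ ^ 8 - 384 * treeZ ^ 9) * treeW_mul_treeZ
  have h3 : 144 * (areaSeries 0 * binomialOp 3 (areaSeries 2)) =
      8 - 114 * treeZ ^ 2 + 129 * treeZ ^ 3 + 1968 * treeZ ^ 4 - 4152 * treeZ ^ 5 - 10380 * treeZ
      ^ 6 + 49974 * treeZ ^ 7 - 80024 * treeZ ^ 8 + 65296 * treeZ ^ 9 - 27426 * treeZ ^ 10 + 4725
      * treeZ ^ 11 - 4 * treeW := by
    linear_combination 144 * binomialOp 3 (areaSeries 2) * areaSeries_zero +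
      (1 - treeW) *
        mul_binomialOp_three_areaSeries_two +
      (4 + 4 * treeZ - 110 * treeZ ^ 2 + 19 * treeZ ^ 3 + 1987 * treeZ ^ 4 - 2165 * treeZ ^ 5 -
      12545 * treeZ ^ 6 + 37429 * treeZ ^ 7 - 42595 * treeZ ^ 8 + 22701 * treeZ ^ 9 - 4725 * treeZ
      ^ 10) * treeW_mul_treeZ
  have h4 : 96 * (areaSeries 0 * binomialOp 2 (areaSeries 3)) =
      4 - treeZ - 50 * treeZ ^ 2 + 283 * treeZ ^ 3 - 332 * treeZ ^ 4 - 5030 * treeZ ^ 5 + 34696 *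
      treeZ ^ 6 - 107240 * treeZ ^ 7 + 189672 * treeZ ^ 8 - 203481 * treeZ ^ 9 + 131306 * treeZ ^
      10 - 47025 * treeZ ^ 11 + 7200 * treeZ ^ 12 - 2 * treeW := by
    linear_combination 96 * binomialOp 2 (areaSeries 3) * areaSeries_zero +
      (1 - treeW) *
        mul_binomialOp_two_areaSeries_three +
      (2 + treeZ - 49 * treeZ ^ 2 + 234 * treeZ ^ 3 - 98 * treeZ ^ 4 - 5128 * treeZ ^ 5 + 29568 *
      treeZ ^ 6 - 77672 * treeZ ^ 7 + 112000 * treeZ ^ 8 - 91481 * treeZ ^ 9 + 39825 * treeZ ^ 10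
      - 7200 * treeZ ^ 11) * treeW_mul_treeZ
  have h5 : 48 * (areaSeries 1 * binomialOp 4 (areaSeries 0)) =
      24 - 25 * treeZ - 8 * treeZ ^ 2 + 56 * treeZ ^ 4 - 14 * treeZ ^ 5 - 120 * treeZ ^ 6 + 158 *
      treeZ ^ 7 - 80 * treeZ ^ 8 + 15 * treeZ ^ 9 - 6 * treeW := by
    linear_combination 24 * binomialOp 4 (areaSeries 0) * mul_areaSeries_one +
      (3 - 3 * treeZ + treeZ ^ 2 - treeW) *
        mul_binomialOp_four_areaSeries_zero +
      (6 + 11 * treeZ + treeZ ^ 2 - 24 * treeZ ^ 3 - 8 * treeZ ^ 4 + 35 * treeZ ^ 5 - 15 * treeZ ^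
      6) * treeW_mul_treeZ
  have h6 : 24 * (areaSeries 1 * binomialOp 3 (areaSeries 1)) =
      3 * treeZ - 8 + 12 * treeZ ^ 2 + 42 * treeZ ^ 3 - 120 * treeZ ^ 4 - 120 * treeZ ^ 5 + 732 *
      treeZ ^ 6 - 1092 * treeZ ^ 7 + 808 * treeZ ^ 8 - 307 * treeZ ^ 9 + 48 * treeZ ^ 10 + 2 *
      treeW := by
    linear_combination 12 * binomialOp 3 (areaSeries 1) * mul_areaSeries_one +
      (3 - 3 * treeZ + treeZ ^ 2 - treeW) *
        mul_binomialOp_three_areaSeries_one +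
      (46 * treeZ ^ 3 - 2 - 9 * treeZ - 7 * treeZ ^ 2 + 30 * treeZ ^ 4 - 175 * treeZ ^ 5 + 163 *
      treeZ ^ 6 - 48 * treeZ ^ 7) * treeW_mul_treeZ
  have h7 : 96 * (areaSeries 1 * binomialOp 2 (areaSeries 2)) =
      11 * treeZ - 8 + 50 * treeZ ^ 2 - 259 * treeZ ^ 3 - 280 * treeZ ^ 4 + 4550 * treeZ ^ 5 -
      13876 * treeZ ^ 6 + 22100 * treeZ ^ 7 - 20976 * treeZ ^ 8 + 11983 * treeZ ^ 9 - 3822 * treeZ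
      ^ 10 + 525 * treeZ ^ 11 + 2 * treeW := by
    linear_combination 48 * binomialOp 2 (areaSeries 2) * mul_areaSeries_one +
      (3 - 3 * treeZ + treeZ ^ 2 - treeW) *
        mul_binomialOp_two_areaSeries_two +
      (55 * treeZ ^ 2 - 2 - treeZ - 93 * treeZ ^ 3 - 725 * treeZ ^ 4 + 2709 * treeZ ^ 5 - 3667 *
      treeZ ^ 6 + 2247 * treeZ ^ 7 - 525 * treeZ ^ 8) * treeW_mul_treeZ
  have h8 : 96 * (areaSeries 1 * binomialOp 1 (areaSeries 3)) =
      13 * treeZ - 8 + 34 * treeZ ^ 2 - 497 * treeZ ^ 3 + 2936 * treeZ ^ 4 - 11094 * treeZ ^ 5 +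
      28012 * treeZ ^ 6 - 47704 * treeZ ^ 7 + 54832 * treeZ ^ 8 - 41943 * treeZ ^ 9 + 20482 *
      treeZ ^ 10 - 5785 * treeZ ^ 11 + 720 * treeZ ^ 12 + 2 * treeW := by
    linear_combination 48 * binomialOp 1 (areaSeries 3) * mul_areaSeries_one +
      (3 - 3 * treeZ + treeZ ^ 2 - treeW) *
        mul_binomialOp_one_areaSeries_three +
      (treeZ - 2 + 45 * treeZ ^ 2 - 367 * treeZ ^ 3 + 1701 * treeZ ^ 4 - 4845 * treeZ ^ 5 + 8007 *
      treeZ ^ 6 - 7447 * treeZ ^ 7 + 3625 * treeZ ^ 8 - 720 * treeZ ^ 9) * treeW_mul_treeZ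
  have h9 : 144 * (areaSeries 2 * binomialOp 3 (areaSeries 0)) =
      6 + 6 * treeZ + 45 * treeZ ^ 2 - 192 * treeZ ^ 3 + 168 * treeZ ^ 4 + 84 * treeZ ^ 5 - 66 *
      treeZ ^ 6 - 300 * treeZ ^ 7 + 442 * treeZ ^ 8 - 234 * treeZ ^ 9 + 45 * treeZ ^ 10 - 4 *
      treeW := by
    linear_combination 6 * binomialOp 3 (areaSeries 0) * mul_areaSeries_two +
      (64 * treeZ ^ 3 - 1 - treeZ - 26 * treeZ ^ 2 - 53 * treeZ ^ 4 + 15 * treeZ ^ 5 + 2 * treeW) *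
        mul_binomialOp_three_areaSeries_zero +
      (4 + 6 * treeZ - 2 * treeZ ^ 2 - 10 * treeZ ^ 3 + 6 * treeZ ^ 4) * treeW_mul_treeZ
  have h10 : 96 * (areaSeries 2 * binomialOp 2 (areaSeries 1)) =
      132 * treeZ ^ 3 - 3 - 8 * treeZ - 21 * treeZ ^ 2 - 78 * treeZ ^ 4 - 168 * treeZ ^ 5 - 282 *
      treeZ ^ 6 + 1746 * treeZ ^ 7 - 2687 * treeZ ^ 8 + 2016 * treeZ ^ 9 - 769 * treeZ ^ 10 + 120
      * treeZ ^ 11 + 2 * treeW := by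
    linear_combination 4 * binomialOp 2 (areaSeries 1) * mul_areaSeries_two +
      (64 * treeZ ^ 3 - 1 - treeZ - 26 * treeZ ^ 2 - 53 * treeZ ^ 4 + 15 * treeZ ^ 5 + 2 * treeW) *
        mul_binomialOp_two_areaSeries_one +
      (38 * treeZ ^ 3 - 2 - 8 * treeZ - 46 * treeZ ^ 4 + 16 * treeZ ^ 5) * treeW_mul_treeZ
  have h11 : 576 * (areaSeries 2 * binomialOp 1 (areaSeries 2)) =
      2 * treeZ - 6 + 51 * treeZ ^ 2 - 360 * treeZ ^ 3 + 741 * treeZ ^ 4 - 1860 * treeZ ^ 5 + 9558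
      * treeZ ^ 6 - 28596 * treeZ ^ 7 + 46940 * treeZ ^ 8 - 45390 * treeZ ^ 9 + 26071 * treeZ ^ 10
      - 8280 * treeZ ^ 11 + 1125 * treeZ ^ 12 + 4 * treeW := by
    linear_combination 24 * binomialOp 1 (areaSeries 2) * mul_areaSeries_two +
      (64 * treeZ ^ 3 - 1 - treeZ - 26 * treeZ ^ 2 - 53 * treeZ ^ 4 + 15 * treeZ ^ 5 + 2 * treeW) *
        mul_binomialOp_one_areaSeries_two +
      (2 * treeZ - 4 + 102 * treeZ ^ 2 - 488 * treeZ ^ 3 + 808 * treeZ ^ 4 - 574 * treeZ ^ 5 + 150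
      * treeZ ^ 6) * treeW_mul_treeZ
  have h12 : 96 * (areaSeries 3 * binomialOp 2 (areaSeries 0)) =
      3 + 2 * treeZ + 19 * treeZ ^ 2 - 130 * treeZ ^ 3 + 430 * treeZ ^ 4 - 908 * treeZ ^ 5 + 998 *
      treeZ ^ 6 - 134 * treeZ ^ 7 - 945 * treeZ ^ 8 + 1082 * treeZ ^ 9 - 505 * treeZ ^ 10 + 90 *
      treeZ ^ 11 - 2 * treeW := by
    linear_combination 2 * binomialOp 2 (areaSeries 0) * mul_areaSeries_three +
      (1 + treeZ + 23 * treeZ ^ 2 - 107 * treeZ ^ 3 + 345 * treeZ ^ 4 - 693 * treeZ ^ 5 + 757 *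
      treeZ ^ 6 - 415 * treeZ ^ 7 + 90 * treeZ ^ 8 - 2 * treeW) *
        mul_binomialOp_two_areaSeries_zero +
      (2 + 2 * treeZ - 2 * treeZ ^ 2) * treeW_mul_treeZ
  have h13 : 96 * (areaSeries 3 * binomialOp 1 (areaSeries 1)) =
      124 * treeZ ^ 3 - 3 - 6 * treeZ - 9 * treeZ ^ 2 - 386 * treeZ ^ 4 + 604 * treeZ ^ 5 + 166 *
      treeZ ^ 6 - 2846 * treeZ ^ 7 + 5921 * treeZ ^ 8 - 6326 * treeZ ^ 9 + 3859 * treeZ ^ 10 -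
      1280 * treeZ ^ 11 + 180 * treeZ ^ 12 + 2 * treeW := by
    linear_combination 2 * binomialOp 1 (areaSeries 1) * mul_areaSeries_three +
      (1 + treeZ + 23 * treeZ ^ 2 - 107 * treeZ ^ 3 + 345 * treeZ ^ 4 - 693 * treeZ ^ 5 + 757 *
      treeZ ^ 6 - 415 * treeZ ^ 7 + 90 * treeZ ^ 8 - 2 * treeW) *
        mul_binomialOp_one_areaSeries_one +
      (10 * treeZ ^ 2 - 2 - 6 * treeZ - 4 * treeZ ^ 3) * treeW_mul_treeZ
  refine sub_eq_zero.1 (eq_zero_of_euler_eq ?_ ?_)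
  · simp only [map_add, map_sub, map_neg, euler_ofNat_mul, euler_ofNat, euler_one, euler_treeZ_pow,
      euler_treeZ, euler_treeW, Nat.cast_ofNat]
    linear_combination 5760 * treeZ * hS + 48 * treeZ * h1 + 120 * treeZ * h2 + 40 * treeZ * h3 +
      60 * treeZ * h4 +
      120 * treeZ * h5 + 240 * treeZ * h6 + 60 * treeZ * h7 + 60 * treeZ * h8 + 40 * treeZ * h9 +
      60 * treeZ * h10 + 10 * treeZ * h11 + 60 * treeZ * h12 + 60 * treeZ * h13 + 5760 * treeZ *
      euler (areaSeries 4) * areaSeries_zero + 5760 * treeZ * areaSeries 4 *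
      mul_binomialOp_one_areaSeries_zero + (-5760 * euler (areaSeries 4) + 152 * treeZ + 152) *
      treeW_mul_treeZ
  · simp only [map_add, map_sub, map_neg, coeff_ofNat_mul, coeff_one_ofNat, coeff_one,
      coeff_one_treeZ_pow,
      coeff_one_treeZ, coeff_one_treeW,
      coeff_succ_areaSeries, areaCoeff_zero_right]
    norm_num

/-! ### Explicit coefficients of the tree series -/

/-- The exponential of the tree series: `∑ₙ areaCoeff 0 n xⁿ`. -/
noncomputable def treeExp : ℝ⟦X⟧ := mk fun n => areaCoeff 0 n

theorem X_mul_treeExp : X * treeExp = areaSeries 0 := rfl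

theorem constantCoeff_treeExp : constantCoeff treeExp = 1 := by
  rw [← coeff_zero_eq_constantCoeff_apply, treeExp, coeff_mk, areaCoeff_zero_right, if_pos rfl]

theorem areaSeries_zero_mul_treeZ : areaSeries 0 * treeZ = treeZ - 1 := by
  rw [areaSeries_zero]
  linear_combination -treeW_mul_treeZ

theorem euler_treeExp : euler treeExp = treeExp * (treeZ - 1) := by
  have hX : euler (X : ℝ⟦X⟧) = X := by
    rw [euler, Derivation.smul_apply, derivative_X, smul_eq_mul, mul_one]
  have h := congrArg euler X_mul_treeExp
  rw [Derivation.leibniz, smul_eq_mul, smul_eq_mul, hX, areaSeries_zero, map_sub, euler_one,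
    euler_treeW] at h
  have h2 := areaSeries_zero_mul_treeZ
  rw [← X_mul_treeExp] at h2
  refine mul_left_cancel₀ (X_ne_zero (R := ℝ)) ?_
  linear_combination h - h2

/-- With E = `treeExp`, θE = E (Z - 1) and Z - 1 = T Z = X E Z. -/
theorem euler_treeExp_pow (b : ℕ) :
    euler (treeExp ^ b) = C (b : ℝ) * (X * (treeExp ^ (b + 1) * treeZ)) := by
  have h2 := areaSeries_zero_mul_treeZ
  rw [← X_mul_treeExp] at h2
  have h3 : C (b : ℝ) = (b : ℝ⟦X⟧) := map_natCast _ b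
  rw [h3]
  cases b with
  | zero => simp
  | succ b =>
    rw [Derivation.leibniz_pow, euler_treeExp, nsmul_eq_mul, smul_eq_mul, Nat.add_sub_cancel]
    linear_combination (-((b + 1 : ℕ) : ℝ⟦X⟧) * treeExp ^ (b + 1)) * h2

theorem succ_mul_coeff_treeExp_pow (m b : ℕ) :
    (m + 1 : ℝ) * coeff (m + 1) (treeExp ^ b) = b * coeff m (treeExp ^ (b + 1) * treeZ) := by
  have h := congrArg (coeff (m + 1)) (euler_treeExp_pow b)
  rw [coeff_euler, coeff_C_mul, coeff_succ_X_mul] at h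
  exact_mod_cast h

/-- A form of Lagrange inversion, by induction on `m` for all `b` at once. From Z = 1 + T Z one gets
E^b Z = E^b + X E^(b+1) Z, and the previous lemma reduces the coefficient of E^b to that of E^(b+1)
Z as well. -/
theorem coeff_treeExp_pow_mul_treeZ (m b : ℕ) :
    coeff m (treeExp ^ b * treeZ) = ((m + b : ℕ) : ℝ) ^ m / m.factorial := by
  induction m generalizing b with
  | zero => simp [constantCoeff_treeExp, constantCoeff_treeZ]
  | succ m ih =>
    have h2 := areaSeries_zero_mul_treeZ
    rw [← X_mul_treeExp] at h2
    have h1 : treeExp ^ b * treeZ = treeExp ^ b + X * (treeExp ^ (b + 1) * treeZ) := by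
      linear_combination (-treeExp ^ b) * h2
    have h3 := succ_mul_coeff_treeExp_pow m b
    rw [h1, map_add, coeff_succ_X_mul]
    rw [ih] at h3 ⊢
    have hm : (m : ℝ) + 1 ≠ 0 := by positivity
    refine mul_left_cancel₀ hm ?_
    rw [mul_add, h3, Nat.factorial_succ]
    push_cast
    field_simp
    ring

theorem areaCoeff_zero_left (n : ℕ) :
    areaCoeff 0 n = ((n : ℝ) + 1) ^ n / (n + 1).factorial := by
  cases n with
  | zero => simp [areaCoeff_zero_right]
  | succ m =>
    have h := succ_mul_coeff_treeExp_pow m 1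
    rw [pow_one, coeff_treeExp_pow_mul_treeZ, treeExp, coeff_mk] at h
    have hm : (m : ℝ) + 1 ≠ 0 := by positivity
    refine mul_left_cancel₀ hm ?_
    rw [h, Nat.factorial_succ (m + 1), Nat.factorial_succ m]
    push_cast
    have : (m : ℝ) + 1 + 1 ≠ 0 := by positivity
    field_simp
    ring

theorem areaCoeff_zero_left_pos (n : ℕ) : 0 < areaCoeff 0 n := by
  rw [areaCoeff_zero_left]
  positivity

/-- Here Z - 1 = T Z, and Z² = Z + T Z² peels off one term T^(i+2) Z at a time. The remainder starts
at x^(n+2), so it is invisible at x^(n+1). -/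
theorem treeZ_sub_one_sq (n : ℕ) :
    (treeZ - 1) ^ 2 = ∑ i ∈ Finset.range n, areaSeries 0 ^ (i + 2) * treeZ +
      areaSeries 0 ^ (n + 2) * treeZ ^ 2 := by
  have h := areaSeries_zero_mul_treeZ
  induction n with
  | zero =>
    rw [Finset.sum_range_zero]
    linear_combination (-(areaSeries 0 * treeZ) - (treeZ - 1)) * h
  | succ n ih =>
    rw [ih, Finset.sum_range_succ]
    linear_combination (-(areaSeries 0 ^ (n + 2) * treeZ)) * h

theorem coeff_treeZ_sub_one_sq (n : ℕ) :
    coeff (n + 1) ((treeZ - 1) ^ 2) =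
      ∑ k ∈ Finset.range n, ((n : ℝ) + 1) ^ k / (k.factorial : ℝ) := by
  rw [treeZ_sub_one_sq n, map_add, map_sum]
  have hlast : coeff (n + 1) (areaSeries 0 ^ (n + 2) * treeZ ^ 2) = 0 := by
    rw [← X_mul_treeExp, mul_pow, mul_assoc, coeff_X_pow_mul', if_neg (by omega)]
  -- T^(i+2) Z contributes the term with index k = n - 1 - i, hence the reversal.
  rw [hlast, add_zero, ← Finset.sum_range_reflect]
  refine Finset.sum_congr rfl fun k hk => ?_
  have hk' := Finset.mem_range.1 hk
  rw [← X_mul_treeExp, mul_pow, mul_assoc, coeff_X_pow_mul', if_pos (by omega),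
    coeff_treeExp_pow_mul_treeZ]
  have h1 : n + 1 - (n - 1 - k + 2) = k := by omega
  have h2 : k + (n - 1 - k + 2) = n + 1 := by omega
  rw [h1, h2]
  push_cast
  rfl

/-! ### Multiplication by powers of n, and the linear relation for the fourth moment -/

/-- The operator `X · d/dX - 1`. -/
noncomputable def eulerSubOne (f : ℝ⟦X⟧) : ℝ⟦X⟧ := euler f - f

theorem coeff_succ_eulerSubOne (f : ℝ⟦X⟧) (n : ℕ) :
    coeff (n + 1) (eulerSubOne f) = n * coeff (n + 1) f := by
  rw [eulerSubOne, map_sub, coeff_euler]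
  push_cast
  ring

theorem coeff_succ_iterate_eulerSubOne (f : ℝ⟦X⟧) (i n : ℕ) :
    coeff (n + 1) (eulerSubOne^[i] f) = (n : ℝ) ^ i * coeff (n + 1) f := by
  induction i with
  | zero => simp
  | succ i ih =>
    rw [Function.iterate_succ_apply', coeff_succ_eulerSubOne, ih]
    ring

theorem iterate_eulerSubOne_one_areaSeries_zero :
    eulerSubOne^[1] (areaSeries 0) =
      treeZ - 2 + treeW := by
  have h := congrArg euler areaSeries_zero
  simp only [map_add, map_sub, map_neg, euler_ofNat_mul, euler_ofNat, euler_one, euler_treeZ_pow,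
    euler_treeZ, euler_treeW, Nat.cast_ofNat] at h
  rw [Function.iterate_one, eulerSubOne]
  linear_combination h - areaSeries_zero

theorem iterate_eulerSubOne_two_areaSeries_zero :
    eulerSubOne^[2] (areaSeries 0) =
      3 - 2 * treeZ - treeZ ^ 2 + treeZ ^ 3 - treeW := by
  have h := congrArg euler iterate_eulerSubOne_one_areaSeries_zero
  simp only [map_add, map_sub, map_neg, euler_ofNat_mul, euler_ofNat, euler_one, euler_treeZ_pow,
    euler_treeZ, euler_treeW, Nat.cast_ofNat] at h
  rw [Function.iterate_succ_apply', eulerSubOne]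
  linear_combination h - iterate_eulerSubOne_one_areaSeries_zero

theorem iterate_eulerSubOne_three_areaSeries_zero :
    eulerSubOne^[3] (areaSeries 0) =
      3 * treeZ - 4 + 3 * treeZ ^ 2 - treeZ ^ 3 - 5 * treeZ ^ 4 + 3 * treeZ ^ 5 + treeW := by
  have h := congrArg euler iterate_eulerSubOne_two_areaSeries_zero
  simp only [map_add, map_sub, map_neg, euler_ofNat_mul, euler_ofNat, euler_one, euler_treeZ_pow,
    euler_treeZ, euler_treeW, Nat.cast_ofNat] at h
  rw [Function.iterate_succ_apply', eulerSubOne]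
  linear_combination h - iterate_eulerSubOne_two_areaSeries_zero

theorem iterate_eulerSubOne_four_areaSeries_zero :
    eulerSubOne^[4] (areaSeries 0) =
      5 - 4 * treeZ - 6 * treeZ ^ 2 - 2 * treeZ ^ 3 + 14 * treeZ ^ 4 + 14 * treeZ ^ 5 - 35 * treeZ
      ^ 6 + 15 * treeZ ^ 7 - treeW := by
  have h := congrArg euler iterate_eulerSubOne_three_areaSeries_zero
  simp only [map_add, map_sub, map_neg, euler_ofNat_mul, euler_ofNat, euler_one, euler_treeZ_pow,
    euler_treeZ, euler_treeW, Nat.cast_ofNat] at h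
  rw [Function.iterate_succ_apply', eulerSubOne]
  linear_combination h - iterate_eulerSubOne_three_areaSeries_zero

theorem iterate_eulerSubOne_five_areaSeries_zero :
    eulerSubOne^[5] (areaSeries 0) =
      5 * treeZ - 6 + 10 * treeZ ^ 2 + 10 * treeZ ^ 3 - 20 * treeZ ^ 4 - 76 * treeZ ^ 5 + 21 *
      treeZ ^ 6 + 265 * treeZ ^ 7 - 315 * treeZ ^ 8 + 105 * treeZ ^ 9 + treeW := by
  have h := congrArg euler iterate_eulerSubOne_four_areaSeries_zero
  simp only [map_add, map_sub, map_neg, euler_ofNat_mul, euler_ofNat, euler_one, euler_treeZ_pow,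
    euler_treeZ, euler_treeW, Nat.cast_ofNat] at h
  rw [Function.iterate_succ_apply', eulerSubOne]
  linear_combination h - iterate_eulerSubOne_four_areaSeries_zero

theorem iterate_eulerSubOne_six_areaSeries_zero :
    eulerSubOne^[6] (areaSeries 0) =
      7 - 6 * treeZ - 15 * treeZ ^ 2 - 25 * treeZ ^ 3 + 10 * treeZ ^ 4 + 186 * treeZ ^ 5 + 279 *
      treeZ ^ 6 - 771 * treeZ ^ 7 - 1414 * treeZ ^ 8 + 4270 * treeZ ^ 9 - 3465 * treeZ ^ 10 + 945
      * treeZ ^ 11 - treeW := by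
  have h := congrArg euler iterate_eulerSubOne_five_areaSeries_zero
  simp only [map_add, map_sub, map_neg, euler_ofNat_mul, euler_ofNat, euler_one, euler_treeZ_pow,
    euler_treeZ, euler_treeW, Nat.cast_ofNat] at h
  rw [Function.iterate_succ_apply', eulerSubOne]
  linear_combination h - iterate_eulerSubOne_five_areaSeries_zero

theorem iterate_eulerSubOne_one_areaSeries_one :
    2 * eulerSubOne^[1] (areaSeries 1) =
      4 * treeZ - 4 + 2 * treeZ ^ 2 - 5 * treeZ ^ 3 + 2 * treeZ ^ 4 + treeW := by
  have h := congrArg euler mul_areaSeries_one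
  simp only [map_add, map_sub, map_neg, euler_ofNat_mul, euler_ofNat, euler_one, euler_treeZ_pow,
    euler_treeZ, euler_treeW, Nat.cast_ofNat] at h
  rw [Function.iterate_one, eulerSubOne]
  linear_combination h - mul_areaSeries_one

theorem iterate_eulerSubOne_two_areaSeries_one :
    2 * eulerSubOne^[2] (areaSeries 1) =
      5 - 5 * treeZ - 6 * treeZ ^ 2 + 5 * treeZ ^ 3 + 17 * treeZ ^ 4 - 23 * treeZ ^ 5 + 8 * treeZ
      ^ 6 - treeW := by
  have h := congrArg euler iterate_eulerSubOne_one_areaSeries_one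
  simp only [map_add, map_sub, map_neg, euler_ofNat_mul, euler_ofNat, euler_one, euler_treeZ_pow,
    euler_treeZ, euler_treeW, Nat.cast_ofNat] at h
  rw [Function.iterate_succ_apply', eulerSubOne]
  linear_combination h - iterate_eulerSubOne_one_areaSeries_one

theorem iterate_eulerSubOne_three_areaSeries_one :
    2 * eulerSubOne^[3] (areaSeries 1) =
      6 * treeZ - 6 + 11 * treeZ ^ 2 + 2 * treeZ ^ 3 - 44 * treeZ ^ 4 - 30 * treeZ ^ 5 + 175 *
      treeZ ^ 6 - 163 * treeZ ^ 7 + 48 * treeZ ^ 8 + treeW := by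
  have h := congrArg euler iterate_eulerSubOne_two_areaSeries_one
  simp only [map_add, map_sub, map_neg, euler_ofNat_mul, euler_ofNat, euler_one, euler_treeZ_pow,
    euler_treeZ, euler_treeW, Nat.cast_ofNat] at h
  rw [Function.iterate_succ_apply', eulerSubOne]
  linear_combination h - iterate_eulerSubOne_two_areaSeries_one

theorem iterate_eulerSubOne_four_areaSeries_one :
    2 * eulerSubOne^[4] (areaSeries 1) =
      7 - 7 * treeZ - 17 * treeZ ^ 2 - 18 * treeZ ^ 3 + 60 * treeZ ^ 4 + 212 * treeZ ^ 5 - 201 *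
      treeZ ^ 6 - 1037 * treeZ ^ 7 + 2143 * treeZ ^ 8 - 1525 * treeZ ^ 9 + 384 * treeZ ^ 10 -
      treeW := by
  have h := congrArg euler iterate_eulerSubOne_three_areaSeries_one
  simp only [map_add, map_sub, map_neg, euler_ofNat_mul, euler_ofNat, euler_one, euler_treeZ_pow,
    euler_treeZ, euler_treeW, Nat.cast_ofNat] at h
  rw [Function.iterate_succ_apply', eulerSubOne]
  linear_combination h - iterate_eulerSubOne_three_areaSeries_one

theorem areaCoeff_four (n : ℕ) :
    24 * areaCoeff 4 n =
      (221 / 1008 * (n : ℝ) ^ 6 + 63737 / 30240 * (n : ℝ) ^ 5 + 101897 / 15120 * (n : ℝ) ^ 4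
          + 22217 / 5040 * (n : ℝ) ^ 3 - 1375 / 189 * (n : ℝ) ^ 2 - 187463 / 30240 * (n : ℝ)) *
        areaCoeff 0 n +
      (-(35 / 16) * (n : ℝ) ^ 4 - 449 / 27 * (n : ℝ) ^ 3 - 130243 / 2520 * (n : ℝ) ^ 2
              - 7409 / 105 * (n : ℝ) - 503803 / 15120) * areaCoeff 1 n := by
  -- The coefficients are those of the two polynomials over the common denominator 30240, and 725760
  -- = 24 · 30240. All series involved have normal forms in W and Z, so the relation is a comparison
  -- of coefficients.
  have h : 725760 * areaSeries 4 =
      6630 * eulerSubOne^[6] (areaSeries 0) + 63737 * eulerSubOne^[5] (areaSeries 0) + 203794 *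
      eulerSubOne^[4] (areaSeries 0) + 133302 * eulerSubOne^[3] (areaSeries 0) - 220000 *
      eulerSubOne^[2] (areaSeries 0) - 187463 * eulerSubOne^[1] (areaSeries 0) - 66150 *
      eulerSubOne^[4] (areaSeries 1) - 502880 * eulerSubOne^[3] (areaSeries 1) - 1562916 *
      eulerSubOne^[2] (areaSeries 1) - 2133792 * eulerSubOne^[1] (areaSeries 1) - 1007606 *
      areaSeries 1 := by
    linear_combination 126 * mul_areaSeries_four - 6630 * iterate_eulerSubOne_six_areaSeries_zero -
      63737 *
      iterate_eulerSubOne_five_areaSeries_zero - 203794 * iterate_eulerSubOne_four_areaSeries_zero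
        - 133302 *
      iterate_eulerSubOne_three_areaSeries_zero + 220000 * iterate_eulerSubOne_two_areaSeries_zero
        + 187463 *
      iterate_eulerSubOne_one_areaSeries_zero + 33075 * iterate_eulerSubOne_four_areaSeries_one +
        251440 *
      iterate_eulerSubOne_three_areaSeries_one + 781458 * iterate_eulerSubOne_two_areaSeries_one +
        1066896 *
      iterate_eulerSubOne_one_areaSeries_one + 503803 * mul_areaSeries_one
  have hn := congrArg (coeff (n + 1)) h
  simp only [map_add, map_sub, coeff_ofNat_mul, coeff_succ_iterate_eulerSubOne,
    coeff_succ_areaSeries] at hn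
  linear_combination hn / 30240

/-! ### From Taylor coefficients back to moments -/

theorem areaCoeff_zero_eq_card (n : ℕ) :
    areaCoeff 0 n = (n.factorial : ℝ)⁻¹ * ((parkingFunctions n).card : ℝ) := by
  rw [areaCoeff_eq]
  simp

theorem prod_range_sub_eq_factorial_mul_choose (a k : ℕ) :
    ∏ j ∈ Finset.range k, ((a : ℝ) - j) = k.factorial * (a.choose k : ℝ) := by
  rw [← Nat.cast_mul, ← Nat.descFactorial_eq_factorial_mul_choose,
    Nat.descFactorial_eq_prod_range, Nat.cast_prod]
  rcases le_or_gt k a with h | h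
  · refine Finset.prod_congr rfl fun j hj => ?_
    rw [Nat.cast_sub ((Finset.mem_range.1 hj).le.trans h)]
  -- For a < k both products contain a zero factor, at j = a.
  · rw [Finset.prod_eq_zero (Finset.mem_range.2 h) (sub_self _),
      Finset.prod_eq_zero (Finset.mem_range.2 h) (by simp)]

theorem areaFactorialMoment_eq (k n : ℕ) :
    areaFactorialMoment k n = k.factorial * areaCoeff k n / areaCoeff 0 n := by
  have h : ∀ p ∈ parkingFunctions n, ∏ j ∈ Finset.range k, (parkingArea p - (j : ℝ)) =
      k.factorial * ((parkingAreaNat p).choose k : ℝ) := fun p hp => by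
    rw [← ((mem_parkingFunctions p).1 hp).cast_parkingAreaNat,
      prod_range_sub_eq_factorial_mul_choose]
  have hn : (n.factorial : ℝ) ≠ 0 := by positivity
  have hc : ((parkingFunctions n).card : ℝ) ≠ 0 := fun h0 => by
    have := areaCoeff_zero_left_pos n
    rw [areaCoeff_zero_eq_card, h0, mul_zero] at this
    exact this.false
  rw [areaFactorialMoment, parkingExpectation, Finset.sum_congr rfl h, ← Finset.mul_sum,
    areaCoeff_zero_eq_card, areaCoeff_eq]
  field_simp

theorem expectedArea_eq (n : ℕ) : expectedArea n = areaCoeff 1 n / areaCoeff 0 n := by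
  have h : expectedArea n = areaFactorialMoment 1 n := by
    simp [expectedArea, areaFactorialMoment]
  rw [h, areaFactorialMoment_eq]
  simp

theorem two_mul_areaCoeff_one (n : ℕ) :
    2 * areaCoeff 1 n = ∑ k ∈ Finset.range n, ((n : ℝ) + 1) ^ k / (k.factorial : ℝ) -
      n * areaCoeff 0 n := by
  -- The square produces the truncated exponential sum, and θ - 1 produces the term -n/2 of the
  -- mean.
  have h : 2 * areaSeries 1 = (treeZ - 1) ^ 2 - eulerSubOne (areaSeries 0) := by
    have h0 := iterate_eulerSubOne_one_areaSeries_zero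
    rw [Function.iterate_one] at h0
    linear_combination mul_areaSeries_one + h0
  have hn := congrArg (coeff (n + 1)) h
  rwa [map_sub, coeff_ofNat_mul, coeff_succ_eulerSubOne, coeff_succ_areaSeries,
    coeff_succ_areaSeries, coeff_treeZ_sub_one_sq] at hn

theorem expectedArea_eq_sum (n : ℕ) :
    expectedArea n =
        -(n : ℝ) / 2 + 1 / 2 * (((n + 1).factorial : ℝ) / ((n : ℝ) + 1) ^ n) *
          ∑ k ∈ Finset.range n, ((n : ℝ) + 1) ^ k / (k.factorial : ℝ) := by
  have h := two_mul_areaCoeff_one n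
  have h0 := (areaCoeff_zero_left_pos n).ne'
  have hinv : ((n + 1).factorial : ℝ) / ((n : ℝ) + 1) ^ n = (areaCoeff 0 n)⁻¹ := by
    rw [areaCoeff_zero_left, inv_div]
  rw [expectedArea_eq, hinv]
  field_simp
  linear_combination h

theorem areaFactorialMoment_four (n : ℕ) :
      areaFactorialMoment 4 n =
        221 / 1008 * (n : ℝ) ^ 6 + 63737 / 30240 * (n : ℝ) ^ 5 + 101897 / 15120 * (n : ℝ) ^ 4
          + 22217 / 5040 * (n : ℝ) ^ 3 - 1375 / 189 * (n : ℝ) ^ 2 - 187463 / 30240 * (n : ℝ)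
          + (-(35 / 16) * (n : ℝ) ^ 4 - 449 / 27 * (n : ℝ) ^ 3 - 130243 / 2520 * (n : ℝ) ^ 2
              - 7409 / 105 * (n : ℝ) - 503803 / 15120) * expectedArea n := by
  have h0 := (areaCoeff_zero_left_pos n).ne'
  have h4 : ((Nat.factorial 4 : ℕ) : ℝ) = 24 := by norm_num [Nat.factorial]
  rw [areaFactorialMoment_eq, expectedArea_eq, h4, areaCoeff_four, add_div,
    mul_div_cancel_right₀ _ h0, mul_div_assoc]

/-! ### Asymptotics -/

theorem factorial_isBigO_rpow :
    (fun m : ℕ => (m.factorial : ℝ)) =O[atTop]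
      fun m : ℕ => (m : ℝ) ^ (1 / 2 : ℝ) * ((m : ℝ) / Real.exp 1) ^ m := by
  refine Stirling.factorial_isEquivalent_stirling.isBigO.trans ?_
  refine IsBigO.of_bound (√(2 * Real.pi)) (Eventually.of_forall fun m => le_of_eq ?_)
  rw [mul_right_comm, Real.sqrt_mul (by positivity), Real.sqrt_eq_rpow (m : ℝ),
    Real.norm_of_nonneg (by positivity), Real.norm_of_nonneg (by positivity), mul_assoc]

theorem natCast_pow_isBigO_rpow {k : ℕ} {r : ℝ} (h : k ≤ r) :
    (fun n : ℕ => (n : ℝ) ^ k) =O[atTop] fun n : ℕ => (n : ℝ) ^ r := by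
  refine IsBigO.of_bound 1 ?_
  filter_upwards [eventually_ge_atTop 1] with n hn
  have hn' : (1 : ℝ) ≤ n := by exact_mod_cast hn
  rw [one_mul, Real.norm_of_nonneg (by positivity), Real.norm_of_nonneg (by positivity),
    ← Real.rpow_natCast]
  exact Real.rpow_le_rpow_of_exponent_le hn' h

/-- The truncated exponential sum is at most e^(n+1), and by Stirling (n+1)! e^(n+1) / (n+1)^n is of
order (n+1)^(3/2). -/
theorem expectedArea_isBigO :
    expectedArea =O[atTop] fun n : ℕ => (n : ℝ) ^ (3 / 2 : ℝ) := by
  have h1 : (fun n : ℕ => (((n + 1).factorial : ℝ) / ((n : ℝ) + 1) ^ n) *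
      ∑ k ∈ Finset.range n, ((n : ℝ) + 1) ^ k / (k.factorial : ℝ)) =O[atTop]
      fun n : ℕ => (n : ℝ) ^ (3 / 2 : ℝ) := by
    have hf := factorial_isBigO_rpow.comp_tendsto (tendsto_add_atTop_nat 1)
    have hg : (fun n : ℕ => Real.exp ((n : ℝ) + 1) / ((n : ℝ) + 1) ^ n) =O[atTop]
        fun n : ℕ => Real.exp ((n : ℝ) + 1) / ((n : ℝ) + 1) ^ n := isBigO_refl _ _
    have hs : (fun n : ℕ => (((n + 1).factorial : ℝ) / ((n : ℝ) + 1) ^ n) *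
        ∑ k ∈ Finset.range n, ((n : ℝ) + 1) ^ k / (k.factorial : ℝ)) =O[atTop]
        fun n : ℕ => ((n + 1).factorial : ℝ) *
          (Real.exp ((n : ℝ) + 1) / ((n : ℝ) + 1) ^ n) := by
      refine IsBigO.of_bound 1 (Eventually.of_forall fun n => ?_)
      have := Real.sum_le_exp_of_nonneg (x := (n : ℝ) + 1) (by positivity) n
      rw [one_mul, Real.norm_of_nonneg (by positivity), Real.norm_of_nonneg (by positivity),
        div_mul_eq_mul_div, mul_div_assoc']
      gcongr
    refine (hs.trans (hf.mul hg)).trans ?_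
    -- The constant comes from n + 1 ≤ 2n for n ≥ 1.
    refine IsBigO.of_bound (2 ^ (3 / 2 : ℝ)) ?_
    filter_upwards [eventually_ge_atTop 1] with n hn
    have hn' : (1 : ℝ) ≤ n := by exact_mod_cast hn
    have hm : (0 : ℝ) < (n : ℝ) + 1 := by positivity
    have he : Real.exp ((n : ℝ) + 1) = Real.exp 1 ^ (n + 1) := by
      rw [← Real.exp_nat_mul]
      push_cast
      ring_nf
    have key : ((n : ℝ) + 1) ^ (1 / 2 : ℝ) * (((n : ℝ) + 1) / Real.exp 1) ^ (n + 1) *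
        (Real.exp ((n : ℝ) + 1) / ((n : ℝ) + 1) ^ n) = ((n : ℝ) + 1) ^ (3 / 2 : ℝ) := by
      rw [he, show (3 / 2 : ℝ) = 1 / 2 + 1 by norm_num, Real.rpow_add_one hm.ne', div_pow,
        pow_succ ((n : ℝ) + 1) n]
      have := (Real.exp_pos 1).ne'
      field_simp
    simp only [Function.comp_apply]
    push_cast
    rw [key, Real.norm_of_nonneg (by positivity), Real.norm_of_nonneg (by positivity),
      ← Real.mul_rpow (by norm_num) (by positivity)]
    exact Real.rpow_le_rpow hm.le (by linarith) (by norm_num)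
  have h2 : (fun n : ℕ => (n : ℝ)) =O[atTop] fun n : ℕ => (n : ℝ) ^ (3 / 2 : ℝ) := by
    simpa using natCast_pow_isBigO_rpow (k := 1) (r := 3 / 2) (by norm_num)
  refine ((h2.const_mul_left (-1 / 2)).add (h1.const_mul_left (1 / 2))).congr_left fun n => ?_
  rw [expectedArea_eq_sum]
  ring

theorem theorem4 :
    (∀ n : ℕ,
      expectedArea n =
        -(n : ℝ) / 2 + 1 / 2 * (((n + 1).factorial : ℝ) / ((n : ℝ) + 1) ^ n) *
          ∑ k ∈ Finset.range n, ((n : ℝ) + 1) ^ k / (k.factorial : ℝ)) ∧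
    (∀ n : ℕ,
      areaFactorialMoment 4 n =
        221 / 1008 * (n : ℝ) ^ 6 + 63737 / 30240 * (n : ℝ) ^ 5 + 101897 / 15120 * (n : ℝ) ^ 4
          + 22217 / 5040 * (n : ℝ) ^ 3 - 1375 / 189 * (n : ℝ) ^ 2 - 187463 / 30240 * (n : ℝ)
          + (-(35 / 16) * (n : ℝ) ^ 4 - 449 / 27 * (n : ℝ) ^ 3 - 130243 / 2520 * (n : ℝ) ^ 2
              - 7409 / 105 * (n : ℝ) - 503803 / 15120) * expectedArea n) ∧
    (fun n : ℕ => areaFactorialMoment 4 n - 221 / 1008 * (n : ℝ) ^ 6)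
      =O[atTop] (fun n : ℕ => (n : ℝ) ^ (11 / 2 : ℝ)) := by
  refine ⟨expectedArea_eq_sum, areaFactorialMoment_four, ?_⟩
  have hp : ∀ k : ℕ, k ≤ 5 → ∀ c : ℝ,
      (fun n : ℕ => c * (n : ℝ) ^ k) =O[atTop] fun n : ℕ => (n : ℝ) ^ (11 / 2 : ℝ) := by
    intro k hk c
    refine (natCast_pow_isBigO_rpow ?_).const_mul_left c
    have : (k : ℝ) ≤ 5 := by exact_mod_cast hk
    linarith
  -- The exponent 11/2 is 4 + 3/2: the degree of the polynomial multiplying E_1 plus the order of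
  -- E_1.
  have hq : ∀ k : ℕ, k ≤ 4 → ∀ c : ℝ,
      (fun n : ℕ => c * (n : ℝ) ^ k * expectedArea n) =O[atTop]
        fun n : ℕ => (n : ℝ) ^ (11 / 2 : ℝ) := by
    intro k hk c
    have h4 : (fun n : ℕ => (n : ℝ) ^ k) =O[atTop] fun n : ℕ => (n : ℝ) ^ (4 : ℝ) :=
      natCast_pow_isBigO_rpow (by exact_mod_cast hk)
    refine ((h4.const_mul_left c).mul expectedArea_isBigO).congr' EventuallyEq.rfl ?_
    filter_upwards [eventually_ge_atTop 1] with n hn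
    have hn' : (0 : ℝ) < n := by exact_mod_cast hn
    rw [← Real.rpow_add hn']
    norm_num
  refine (((((((((hp 5 le_rfl (63737 / 30240)).add (hp 4 (by norm_num) (101897 / 15120))).add
    (hp 3 (by norm_num) (22217 / 5040))).add (hp 2 (by norm_num) (-1375 / 189))).add
    (hp 1 (by norm_num) (-187463 / 30240))).add (hq 4 le_rfl (-35 / 16))).add
    (hq 3 (by norm_num) (-449 / 27))).add (hq 2 (by norm_num) (-130243 / 2520))).add
    ((hq 1 (by norm_num) (-7409 / 105)).add (hq 0 (by norm_num) (-503803 / 15120)))).congr_left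
    fun n => ?_
  rw [areaFactorialMoment_four]
  ring
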